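/- Logarithms are natural, $\log^{(0)}n=n$ and $\log^{(i)}n=\log(\log^{(i-1)}n)$. Let $G=(V,E)$ be a finite simple graph with $n$ nodes and maximum degree $\Delta$, and let $0<\epsilon\le 1/1000$ and $C>0$. For $x:E\to\mathbb R$ write $|x|=\sum_{e\in E}x_e$ and $c_v=\sum_{e\ni v}x_e$; $x$ is a fractional matching if $x\ge 0$ and $c_v\le 1$ for every node $v$. **Sampling-based algorithm.** Put $w_j=(1+\epsilon)^j/\Delta$ for $j\ge 0$ and $w_{-1}=0$. Round $j$ is in phase $i(j)$, the smallest $i\ge 1$ with $w_j\le 1/(\log^{(i)}n)^5$, and $p_i=\min\{1,\,C/(\log^{(i)}n)^4\}$. All nodes are active at the beginning of round $0$. In round $j=0,1,2,\dots$: - *Sampling part.* As long as no phase $i$ with $1/\log^{(i)}n>\epsilon\log(1+\epsilon)/1000$ has been reached (in round $j$ or earlier), fresh random sets $S_h^j\subseteq V$, $0\le h\le j$, are drawn, each containing each node with probability $p_{i(h)}$, all these choices being independent (over all $j$, $h$ and nodes). Let $A_h^j$ be the set of the nodes of $S_h^j$ that were active in round $h$. Every node $v$ that is still active computes $\tilde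 c_v=\sum_{h=0}^{j}\frac{|A_h^j\cap N(v)|}{p_{i(h)}}(w_h-w_{h-1})$ and is frozen (is not active in later rounds) if $\tilde c_v>1-10\epsilon$. - *Vanilla part.* From the first round on in which such a phase has been reached, every node is sampled, so that an active node $v$ knows its true value $c_v$, in which the edge to a neighbor $u$ counts $w_k$ if $u$ was frozen in round $k<j$ and $w_j$ if $u$ is active; $v$ is frozen if $c_v\ge 1-\epsilon$. The algorithm ends when no edge has two active endpoints. An edge $e=\{u,v\}$ then receives $x_e=w_j$, where $j$ is the last round in which $u$ and $v$ were both active. Finally $c_v=\sum_{e\ni v}x_e$ is computed for every $v$, and the values of all edges incident to a node with $c_v>1$ are set to $0$. Let $\bar M$ be the resulting assignment. **Theorem.** (1) In every execution, $\bar M$ is a fractional matching. (2) There is an absolute constant $K>0$ such that for every $0<\epsilon\le 1/1000$ and every sufficiently large constant $C$ (that is, $C\ge C_0(\epsilon)$) the following holds. If $M^*$ is a maximum fractional matching of a graph $G$ with $n$ nodes and $|M^*|\ge K(\log n)^{18}$, then with probability at least $1-n^{-6}$ $$(2+100\epsilon)\,|\bar M|\ \ge\ |M^*|.$$ -/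

import Mathlib

open MeasureTheory ProbabilityTheory

namespace SampledMatching

variable {V : Type*} [Fintype V] [DecidableEq V] (G : SimpleGraph V) [DecidableRel G.Adj]

section FractionalMatching

/-- The value `c_v = ∑_{e ∋ v} x_e` of a node under an assignment of values to the edges. -/
def nodeValue (x : Sym2 V → ℝ) (v : V) : ℝ := ∑ e ∈ G.incidenceFinset v, x e

/-- The size `|M| = ∑_e x_e` of an assignment of values to the edges. -/
def size (x : Sym2 V → ℝ) : ℝ := ∑ e ∈ G.edgeFinset, x e

/-- A fractional matching: nonnegative edge values with `c_v ≤ 1` at every node. (Only the values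
on edges of `G` matter.) -/
def IsFractionalMatching (x : Sym2 V → ℝ) : Prop :=
  (∀ e ∈ G.edgeSet, 0 ≤ x e) ∧ ∀ v, nodeValue G x v ≤ 1

/-- A fractional matching of maximum size. -/
def IsMaxFractionalMatching (x : Sym2 V → ℝ) : Prop :=
  IsFractionalMatching G x ∧ ∀ y, IsFractionalMatching G y → size G y ≤ size G x

end FractionalMatching

section Parameters

/-- The `i`-fold iterated logarithm `log^{(i)} n` of the number `n` of nodes; `log^{(0)} n = n`. -/
noncomputable def iterLog (V : Type*) [Fintype V] (i : ℕ) : ℝ :=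
  Real.log^[i] (Fintype.card V : ℝ)

/-- The weight `w_j = (1 + ε)^j / Δ` of active edges in round `j`. -/
noncomputable def weight (ε : ℝ) (j : ℕ) : ℝ := (1 + ε) ^ j / (G.maxDegree : ℝ)

/-- The increment `w_h - w_{h-1}`, with `w_{-1} = 0`. -/
noncomputable def weightIncrement (ε : ℝ) : ℕ → ℝ
  | 0 => weight G ε 0
  | h + 1 => weight G ε (h + 1) - weight G ε h

/-- The phase `i(j)` of round `j`: the smallest `i ≥ 1` with `w_j ≤ 1 / (log^{(i)} n)^5`. -/
noncomputable def phase (ε : ℝ) (j : ℕ) : ℕ :=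
  sInf {i : ℕ | 1 ≤ i ∧ weight G ε j ≤ 1 / iterLog V i ^ 5}

/-- The algorithm has switched to the vanilla algorithm by round `j`: it has reached a phase `i`
with `1 / log^{(i)} n > ε log (1 + ε) / 1000`. -/
def IsVanilla (ε : ℝ) (j : ℕ) : Prop :=
  ∃ k ≤ j, 1 / iterLog V (phase G ε k) > ε * (Real.log (1 + ε) / 1000)

/-- The sampling probability `p_{i(h)} = C / (log^{(i(h))} n)^4`, clipped to `[0, 1]`. -/
noncomputable def samplingProb (ε C : ℝ) (h : ℕ) : unitInterval :=
  Set.projIcc 0 1 zero_le_one (C / iterLog V (phase G ε h) ^ 4)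

end Parameters

section Algorithm

/-- An outcome of all the coin flips: node `v` belongs to the set `S_h^j`, sampled in round `j` for
the earlier or current round `h ≤ j`, iff the coin `(j, h, v)` shows `true`. -/
abbrev Coins (V : Type*) : Type _ := ℕ × ℕ × V → Bool

/-- The law of the coin flips: they are independent, and coin `(j, h, v)` shows `true` with
probability `p_{i(h)}`. -/
noncomputable def coinLaw (ε C : ℝ) : Measure (Coins V) :=
  Measure.infinitePi fun q : ℕ × ℕ × V =>
    bernoulliMeasure true false (samplingProb G ε C q.2.1)

/-- The state at the beginning of a round: `κ v` is the round in which `v` was frozen, and `⊤` if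
`v` is still active. In particular `v` was active in round `h` iff `h ≤ κ v`. -/
abbrev State (V : Type*) : Type _ := V → ℕ∞

/-- The true value `c_v` of an active node `v` at the beginning of round `j`: the edge to a
neighbor `u` has value `w_k` if `u` was frozen in round `k < j`, and `w_j` if `u` is active. -/
noncomputable def trueValue (ε : ℝ) (κ : State V) (j : ℕ) (v : V) : ℝ :=
  ∑ u ∈ G.neighborFinset v, if κ u = ⊤ then weight G ε j else weight G ε (κ u).toNat

open Classical in
/-- The estimate of the value of `v` in round `j`, from the neighbors `A_h^j ∩ N(v)` that were
active in round `h` and are in the sample `S_h^j`, for `h = 0, …, j`. -/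
noncomputable def estimate (ε C : ℝ) (ω : Coins V) (κ : State V) (j : ℕ) (v : V) : ℝ :=
  ∑ h ∈ Finset.range (j + 1),
    (((G.neighborFinset v).filter fun u => (h : ℕ∞) ≤ κ u ∧ ω (j, h, u) = true).card : ℝ)
      / (samplingProb G ε C h : ℝ) * weightIncrement G ε h

/-- The rule by which an active node `v` decides to freeze in round `j`: in the vanilla part all
neighbors are sampled, so `v` knows `c_v` exactly and freezes when it is tight (`c_v ≥ 1 - ε`);
before that, `v` freezes when its estimate exceeds `1 - 10 ε`. -/
def Freezes (ε C : ℝ) (ω : Coins V) (κ : State V) (j : ℕ) (v : V) : Prop :=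
  (IsVanilla G ε j ∧ trueValue G ε κ j v ≥ 1 - ε) ∨
    (¬ IsVanilla G ε j ∧ estimate G ε C ω κ j v > 1 - 10 * ε)

open Classical in
/-- The state of the algorithm at the beginning of round `j`. -/
noncomputable def run (ε C : ℝ) (ω : Coins V) : ℕ → State V
  | 0 => fun _ => ⊤
  | j + 1 => fun v =>
      if run ε C ω j v = ⊤ ∧ Freezes G ε C ω (run ε C ω j) j v then (j : ℕ∞) else run ε C ω j v

/-- The round in which node `v` is frozen during the whole execution (`⊤` if never). -/
noncomputable def freezeRound (ε C : ℝ) (ω : Coins V) (v : V) : ℕ∞ := ⨅ j, run G ε C ω j v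

/-- The value `x_e = w_j` given to the edge `e` once the algorithm has finished, where `j` is the
last round in which both endpoints of `e` were active (it exists by `bddAbove_activeRounds`). -/
noncomputable def edgeValue (ε C : ℝ) (ω : Coins V) (e : Sym2 V) : ℝ :=
  weight G ε (sSup {j : ℕ | ∀ v ∈ e, (j : ℕ∞) ≤ freezeRound G ε C ω v})

open Classical in
/-- The output of the algorithm: the values of all edges incident to a node with `c_v > 1` are set
to `0`. -/
noncomputable def output (ε C : ℝ) (ω : Coins V) (e : Sym2 V) : ℝ :=
  if ∀ v ∈ e, nodeValue G (edgeValue G ε C ω) v ≤ 1 then edgeValue G ε C ω e else 0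

end Algorithm

section Termination

set_option linter.unusedSectionVars false

theorem exists_isVanilla {ε : ℝ} (hε : 0 < ε) (hε' : ε ≤ 1) (hΔ : 0 < G.maxDegree) :
    ∃ j, IsVanilla G ε j := by
  have hΔ' : (1 : ℝ) ≤ G.maxDegree := by exact_mod_cast hΔ
  have hcard : (1 : ℝ) < Fintype.card V := by
    have hV : Nonempty V := by
      by_contra h
      rw [not_nonempty_iff] at h
      simp at hΔ
    have := G.maxDegree_lt_card_verts
    exact_mod_cast (show 1 < Fintype.card V by omega)
  -- a round with weight in `[1/2, 1]`
  obtain ⟨j, hj, hj1⟩ := exists_nat_pow_near (x := (G.maxDegree : ℝ)) (y := 1 + ε) hΔ' (by linarith)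
  have hw1 : weight G ε j ≤ 1 := by
    unfold weight
    rw [div_le_one (by linarith)]
    exact hj
  have hw2 : 1 / 2 < weight G ε j := by
    unfold weight
    rw [div_lt_div_iff₀ (by norm_num) (by linarith)]
    have : (1 + ε) ^ (j + 1) ≤ (1 + ε) ^ j * 2 := by
      rw [pow_succ]; gcongr; linarith
    linarith
  -- an iterated logarithm in `(0, 1]`
  have hlog : ∃ i, 1 ≤ i ∧ 0 < iterLog V i ∧ iterLog V i ≤ 1 := by
    have hs : ∀ i, iterLog V (i + 1) = Real.log (iterLog V i) := fun i =>
      Function.iterate_succ_apply' _ _ _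
    have h0 : iterLog V 0 = Fintype.card V := rfl
    have hex : ∃ i, iterLog V i ≤ 1 := by
      by_contra! hall
      have hdec : ∀ i : ℕ, iterLog V i ≤ Fintype.card V - i := by
        intro i
        induction i with
        | zero => simp [h0]
        | succ i ih =>
          have := Real.log_le_sub_one_of_pos (zero_lt_one.trans (hall i))
          rw [hs]; push_cast; linarith
      have := hdec (Fintype.card V)
      have := hall (Fintype.card V)
      simp at *
      linarith
    classical
    have hspec := Nat.find_spec hex
    have hmin := fun k => Nat.find_min (H := hex) (m := k)
    rcases hk : Nat.find hex with _ | k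
    · rw [hk, h0] at hspec; linarith
    · refine ⟨k + 1, by omega, ?_, hk ▸ hspec⟩
      have := hmin k (by omega)
      rw [hs]
      exact Real.log_pos (not_le.mp this)
  obtain ⟨i, hi1, hi0, hi2⟩ := hlog
  have hne : {i : ℕ | 1 ≤ i ∧ weight G ε j ≤ 1 / iterLog V i ^ 5}.Nonempty := by
    refine ⟨i, hi1, hw1.trans ?_⟩
    rw [le_div_iff₀ (by positivity), one_mul]
    exact pow_le_one₀ hi0.le hi2
  have hmem : 1 ≤ phase G ε j ∧ weight G ε j ≤ 1 / iterLog V (phase G ε j) ^ 5 := Nat.sInf_mem hne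
  refine ⟨j, j, le_rfl, ?_⟩
  set L := iterLog V (phase G ε j)
  have h5 : 0 < 1 / L ^ 5 := by linarith [hmem.2]
  have hL5 : 0 < L ^ 5 := by simpa using h5
  have hL0 : 0 < L := (Odd.pow_pos_iff (by decide)).mp hL5
  have hL5' : L ^ 5 < 2 := by
    have := hw2.trans_le hmem.2
    rw [div_lt_div_iff₀ (by norm_num) hL5] at this
    linarith
  have hL2 : L ≤ 2 := by
    by_contra! h
    have : (2 : ℝ) ^ 5 < L ^ 5 := by gcongr
    norm_num at this
    linarith
  have hl : Real.log (1 + ε) ≤ 1 := by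
    have := Real.log_le_sub_one_of_pos (show 0 < 1 + ε by linarith)
    linarith
  have : 1 / 2 ≤ 1 / L := one_div_le_one_div_of_le hL0 hL2
  have hl0 : 0 ≤ Real.log (1 + ε) := Real.log_nonneg (by linarith)
  nlinarith

theorem run_antitone (ε C : ℝ) (ω : Coins V) (v : V) : Antitone fun j => run G ε C ω j v := by
  refine antitone_nat_of_succ_le fun j => ?_
  simp only [run]
  split_ifs with h
  · rw [h.1]; exact le_top
  · exact le_rfl

/-- The algorithm finishes: in every execution, the two endpoints of an edge are both active in
finitely many rounds only. -/
theorem bddAbove_activeRounds {ε : ℝ} (hε : 0 < ε) (hε' : ε ≤ 1) (C : ℝ) (ω : Coins V)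
    {e : Sym2 V} (he : e ∈ G.edgeSet) :
    BddAbove {j : ℕ | ∀ v ∈ e, (j : ℕ∞) ≤ freezeRound G ε C ω v} := by
  induction e with | _ u v => ?_
  rw [SimpleGraph.mem_edgeSet] at he
  have hΔ : 0 < G.maxDegree :=
    ((G.degree_pos_iff_exists_adj u).mpr ⟨v, he⟩).trans_le (G.degree_le_maxDegree u)
  obtain ⟨j₀, k, hk, hvan⟩ := exists_isVanilla G hε hε' hΔ
  obtain ⟨j₁, hj₁⟩ := pow_unbounded_of_one_lt (G.maxDegree : ℝ) (show 1 < 1 + ε by linarith)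
  set j := max j₀ j₁ with hjdef
  have hw : ∀ h, 0 ≤ weight G ε h := fun h => by unfold weight; positivity
  have hwj : 1 - ε ≤ weight G ε j := by
    have h1 : (G.maxDegree : ℝ) ≤ (1 + ε) ^ j :=
      hj₁.le.trans (pow_le_pow_right₀ (by linarith) (le_max_right _ _))
    have : 1 ≤ weight G ε j := by
      unfold weight
      rwa [one_le_div (by exact_mod_cast hΔ)]
    linarith
  have key : run G ε C ω (j + 1) u ≠ ⊤ ∨ run G ε C ω (j + 1) v ≠ ⊤ := by
    by_contra! htop
    have hju : run G ε C ω j u = ⊤ := top_le_iff.mp (htop.1 ▸ run_antitone G ε C ω u (Nat.le_succ j))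
    have hjv : run G ε C ω j v = ⊤ := top_le_iff.mp (htop.2 ▸ run_antitone G ε C ω v (Nat.le_succ j))
    have hval : 1 - ε ≤ trueValue G ε (run G ε C ω j) j u := by
      refine hwj.trans ?_
      unfold trueValue
      have hmem : v ∈ G.neighborFinset u := by simpa using he
      refine le_trans (le_of_eq (by rw [if_pos hjv])) (Finset.single_le_sum
        (f := fun z => if run G ε C ω j z = ⊤ then weight G ε j
          else weight G ε (run G ε C ω j z).toNat) (fun z _ => ?_) hmem)
      split_ifs <;> exact hw _
    have hf : Freezes G ε C ω (run G ε C ω j) j u :=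
      Or.inl ⟨⟨k, hk.trans (le_max_left _ _), hvan⟩, hval⟩
    have h := htop.1
    simp only [run] at h
    rw [if_pos ⟨hju, hf⟩] at h
    exact ENat.natCast_ne_top j h
  have fin : ∀ z, z ∈ s(u, v) → run G ε C ω (j + 1) z ≠ ⊤ →
      BddAbove {j : ℕ | ∀ v' ∈ s(u, v), (j : ℕ∞) ≤ freezeRound G ε C ω v'} := by
    intro z hz hne
    refine ⟨(run G ε C ω (j + 1) z).toNat, fun m hm => ?_⟩
    have h1 : (m : ℕ∞) ≤ run G ε C ω (j + 1) z := (hm z hz).trans (iInf_le _ _)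
    rw [← ENat.natCast_toNat hne] at h1
    exact_mod_cast h1
  rcases key with h | h
  · exact fin u (Sym2.mem_mk_left u v) h
  · exact fin v (Sym2.mem_mk_right u v) h

end Termination

end SampledMatching

/-! Let c_v be the current value of a node (`load`), and let its surplus in a sampling round be the
amount by which the error of the estimate exceeds ε max(1, c_v). The deterministic core is
`size_le_of_sum_totalSurplus_le`: the output is good once the surpluses of active nodes, summed over
all sampling rounds, are at most ε²|M*|. Values start at most 1 and grow by a factor of at most 1 +
ε per round, so a node that ends above 1 was wrongly kept active in a sampling round, with surplus
at least ε times its final value. A node frozen below 1 - 12ε had surplus at least ε when it froze.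
Hence trimming costs at most ε|M*|, and all but ε|M*| of the frozen nodes are nearly tight. The
frozen nodes form a vertex cover, so there are at least |M*| of them, while the values of all nodes
sum to 2|x|.

It remains to bound the surpluses. The samples of a round are fresh, so for a fixed state an
estimate is a linear form in independent coins with mean c_v. The choice of p_i keeps its
coefficients below 1/(C log^(i) n), except at coins with p = 1, which are deterministic. An
exponential moment bound then gives expected surplus at most 2ε w_j c_v (`coinAvgs_surplus_le`),
because minimality of the phase forces exp(-5 log^(i) n) ≤ w_j. As long as the earlier surpluses are
small, the values sum to at most 5|M*| (`sum_load_le`), so round j contributes O(ε w_j |M*|) in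
expectation; the weights form a geometric series that stays tiny until the vanilla part.

Around its mean the total surplus of a round is concentrated (`coinAvgs_totalSurplus_tail`). One
coin moves it by at most (log n)^5, because values above log n are unlikely
(`coinAvgs_estimate_tail`); this is where |M*| ≥ 200 (log n)^18 enters. There are at most (log n)^2
sampling rounds. Outside a union of unlikely failures, induction on the round closes the argument
(`sum_totalSurplus_le_of_no_failure`, `one_sub_le_coinLaw`). Conditioning on the past is done by
explicit averages over the finitely many coins of a round (`coinLaw_real_le_of_state`). -/

namespace SampledMatching

set_option linter.unusedSectionVars false

/-! ### Averages over independent coins and exponential moments under bounded differences. -/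

section CoinAverage

variable {ι : Type*}

theorem measurableSet_of_finite_coins {B : Set (ι → Bool)} (s : Finset ι)
    (h : ∀ ω ω', (∀ i ∈ s, ω i = ω' i) → ω ∈ B → ω' ∈ B) : MeasurableSet B := by
  have : B = s.restrict ⁻¹' (s.restrict '' B) := by
    refine (Set.subset_preimage_image _ _).antisymm ?_
    rintro ω' ⟨ω, hω, he⟩
    exact h ω ω' (fun i hi => congrFun he ⟨i, hi⟩) hω
  rw [this]
  exact (Finset.measurable_restrict s) (Set.toFinite _).measurableSet

/-- The law of independent coins, where coin `i` shows `true` with probability `P i`. -/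
noncomputable def coinMeasure (P : ι → unitInterval) : Measure (ι → Bool) :=
  Measure.infinitePi fun i => bernoulliMeasure true false (P i)

instance (P : ι → unitInterval) : IsProbabilityMeasure (coinMeasure P) := by
  unfold coinMeasure; infer_instance

theorem integrable_coinMeasure_of_mem_Icc (P : ι → unitInterval) {f : (ι → Bool) → ℝ}
    (hf : Measurable f) (hb : ∀ ω, f ω ∈ Set.Icc 0 1) : Integrable f (coinMeasure P) := by
  refine Integrable.of_bound hf.aestronglyMeasurable 1 (ae_of_all _ fun ω => ?_)
  rw [Real.norm_eq_abs, abs_of_nonneg (hb ω).1]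
  exact (hb ω).2

variable [DecidableEq ι]

/-- Average of `f` over the coin `i`, which shows `true` with probability `p i`. -/
def coinAvg (p : ι → ℝ) (i : ι) (f : (ι → Bool) → ℝ) : (ι → Bool) → ℝ := fun ω =>
  p i * f (Function.update ω i true) + (1 - p i) * f (Function.update ω i false)

/-- Average of `f` over the coins in the list `l`. -/
def coinAvgs (p : ι → ℝ) : List ι → ((ι → Bool) → ℝ) → (ι → Bool) → ℝ
  | [], f => f
  | i :: l, f => coinAvg p i (coinAvgs p l f)

variable {p : ι → ℝ}

theorem coinAvg_mono (h0 : ∀ i, 0 ≤ p i) (h1 : ∀ i, p i ≤ 1) {f g : (ι → Bool) → ℝ}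
    (h : ∀ ω, f ω ≤ g ω) (i : ι) (ω : ι → Bool) : coinAvg p i f ω ≤ coinAvg p i g ω :=
  add_le_add (mul_le_mul_of_nonneg_left (h _) (h0 i))
    (mul_le_mul_of_nonneg_left (h _) (sub_nonneg.2 (h1 i)))

theorem coinAvgs_mono (h0 : ∀ i, 0 ≤ p i) (h1 : ∀ i, p i ≤ 1) {f g : (ι → Bool) → ℝ}
    (h : ∀ ω, f ω ≤ g ω) (l : List ι) : ∀ ω, coinAvgs p l f ω ≤ coinAvgs p l g ω := by
  induction l with
  | nil => exact h
  | cons i l ih => exact coinAvg_mono h0 h1 ih i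

theorem coinAvgs_const (c : ℝ) (l : List ι) : coinAvgs p l (fun _ => c) = fun _ => c := by
  induction l with
  | nil => rfl
  | cons i l ih => funext ω; simp only [coinAvgs, ih, coinAvg]; ring

theorem coinAvgs_add (f g : (ι → Bool) → ℝ) (l : List ι) :
    coinAvgs p l (fun ω => f ω + g ω) = fun ω => coinAvgs p l f ω + coinAvgs p l g ω := by
  induction l with
  | nil => rfl
  | cons i l ih => funext ω; simp only [coinAvgs, ih, coinAvg]; ring

theorem coinAvgs_const_mul (c : ℝ) (f : (ι → Bool) → ℝ) (l : List ι) :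
    coinAvgs p l (fun ω => c * f ω) = fun ω => c * coinAvgs p l f ω := by
  induction l with
  | nil => rfl
  | cons i l ih => funext ω; simp only [coinAvgs, ih, coinAvg]; ring

theorem coinAvgs_sum {α : Type*} (s : Finset α) (f : α → (ι → Bool) → ℝ) (l : List ι) :
    coinAvgs p l (fun ω => ∑ a ∈ s, f a ω) = fun ω => ∑ a ∈ s, coinAvgs p l (f a) ω := by
  classical
  induction s using Finset.induction_on with
  | empty => simpa using coinAvgs_const 0 l
  | insert a s ha ih => simp only [Finset.sum_insert ha, coinAvgs_add, ih]

/-- A quantity that does not depend on the coins of `l` may be frozen when averaging over `l`. -/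
theorem coinAvgs_freeze {α : Type*} (S : (ι → Bool) → α) (F : α → (ι → Bool) → ℝ) (l : List ι)
    (hS : ∀ ω, ∀ i ∈ l, ∀ b, S (Function.update ω i b) = S ω) :
    ∀ ω, coinAvgs p l (fun ω' => F (S ω') ω') ω = coinAvgs p l (F (S ω)) ω := by
  induction l with
  | nil => intro ω; rfl
  | cons i l ih =>
    intro ω
    have ih := ih fun ω k hk b => hS ω k (List.mem_cons_of_mem _ hk) b
    simp only [coinAvgs, coinAvg, ih, hS ω i List.mem_cons_self]

theorem coinAvgs_eval_eq_zero {i : ι} (g : Bool → ℝ) (hg : p i * g true + (1 - p i) * g false = 0)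
    {l : List ι} (hi : i ∈ l) : coinAvgs p l (fun ω => g (ω i)) = fun _ => 0 := by
  have hne : ∀ l : List ι, i ∉ l → coinAvgs p l (fun ω => g (ω i)) = fun ω => g (ω i) := by
    intro l
    induction l with
    | nil => intro _; rfl
    | cons k l ih =>
      intro h
      rw [List.mem_cons, not_or] at h
      funext ω
      simp only [coinAvgs, ih h.2, coinAvg, Function.update_of_ne h.1]
      ring
  induction l with
  | nil => simp at hi
  | cons k l ih =>
    by_cases hl : i ∈ l
    · funext ω; simp [coinAvgs, ih hl, coinAvg]
    · obtain rfl : i = k := by simpa [hl] using hi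
      funext ω
      simp [coinAvgs, hne l hl, coinAvg, hg]

theorem exp_le_one_add_add_sq {x : ℝ} (hx : |x| ≤ 1) : Real.exp x ≤ 1 + x + x ^ 2 := by
  have := (abs_le.1 (Real.abs_exp_sub_one_sub_id_le hx)).2
  linarith

/-- Expand exp to second order around the mean of the two values; the variance of the coin gives p(1
- p)δ². A coin with p = 1 is constant and needs no bound on δ, which matters because clipped
probabilities come with no such bound. -/
theorem coinAvg_exp_le (h0 : ∀ i, 0 ≤ p i) (h1 : ∀ i, p i ≤ 1) {f : (ι → Bool) → ℝ} {i : ι} {δ : ℝ}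
    (hδ : δ ≤ 1 ∨ p i = 1)
    (hf : ∀ ω, |f (Function.update ω i true) - f (Function.update ω i false)| ≤ δ) (ω : ι → Bool) :
    coinAvg p i (fun ω => Real.exp (f ω)) ω
      ≤ Real.exp (coinAvg p i f ω + p i * (1 - p i) * δ ^ 2) := by
  rcases hδ with hδ | hp
  swap
  · simp [coinAvg, hp]
  have h := hf ω
  simp only [coinAvg]
  generalize f (Function.update ω i true) = x at *
  generalize f (Function.update ω i false) = y at *
  have hp0 := h0 i
  have hp1 := h1 i
  generalize p i = q at *
  have hq : 0 ≤ 1 - q := by linarith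
  have hd : |x - y| ≤ 1 := h.trans hδ
  have hsq : (x - y) ^ 2 ≤ δ ^ 2 := by rw [← sq_abs]; gcongr
  have hx : Real.exp x = Real.exp (q * x + (1 - q) * y) * Real.exp ((1 - q) * (x - y)) := by
    rw [← Real.exp_add]; congr 1; ring
  have hy : Real.exp y = Real.exp (q * x + (1 - q) * y) * Real.exp (-q * (x - y)) := by
    rw [← Real.exp_add]; congr 1; ring
  have e1 : Real.exp ((1 - q) * (x - y)) ≤ _ := exp_le_one_add_add_sq (by
    rw [abs_mul, abs_of_nonneg hq]
    exact mul_le_one₀ (by linarith) (abs_nonneg _) hd)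
  have e2 : Real.exp (-q * (x - y)) ≤ _ := exp_le_one_add_add_sq (by
    rw [abs_mul, abs_neg, abs_of_nonneg hp0]
    exact mul_le_one₀ hp1 (abs_nonneg _) hd)
  rw [Real.exp_add, hx, hy]
  -- The linear terms cancel, and q(1 - q)² + (1 - q)q² = q(1 - q).
  have key : q * Real.exp ((1 - q) * (x - y)) + (1 - q) * Real.exp (-q * (x - y))
      ≤ Real.exp (q * (1 - q) * δ ^ 2) := by
    have := mul_le_mul_of_nonneg_left e1 hp0
    have := mul_le_mul_of_nonneg_left e2 hq
    have h3 : q * (1 - q) * (x - y) ^ 2 ≤ q * (1 - q) * δ ^ 2 := by gcongr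
    have := Real.add_one_le_exp (q * (1 - q) * δ ^ 2)
    nlinarith
  have := mul_le_mul_of_nonneg_left key (Real.exp_pos (q * x + (1 - q) * y)).le
  nlinarith

/-- Averaging over another coin is a convex combination; averaging over `k` itself removes the
dependence on `k`. -/
theorem coinAvg_lipschitz (h0 : ∀ i, 0 ≤ p i) (h1 : ∀ i, p i ≤ 1) {f : (ι → Bool) → ℝ} {k : ι}
    {δ : ℝ} (hf : ∀ ω, |f (Function.update ω k true) - f (Function.update ω k false)| ≤ δ) (i : ι)
    (ω : ι → Bool) : |coinAvg p i f (Function.update ω k true)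
      - coinAvg p i f (Function.update ω k false)| ≤ δ := by
  simp only [coinAvg]
  by_cases hik : i = k
  · subst hik
    simpa using (abs_nonneg _).trans (hf ω)
  · simp only [fun b c => Function.update_comm (fun h => hik h.symm) b c ω]
    have a := abs_le.1 (hf (Function.update ω i true))
    have b := abs_le.1 (hf (Function.update ω i false))
    have hp0 := h0 i
    have hp1 : 0 ≤ 1 - p i := sub_nonneg.2 (h1 i)
    rw [abs_le]
    constructor <;> nlinarith

theorem coinAvgs_lipschitz (h0 : ∀ i, 0 ≤ p i) (h1 : ∀ i, p i ≤ 1) {f : (ι → Bool) → ℝ} {k : ι}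
    {δ : ℝ} (hf : ∀ ω, |f (Function.update ω k true) - f (Function.update ω k false)| ≤ δ)
    (l : List ι) : ∀ ω, |coinAvgs p l f (Function.update ω k true)
      - coinAvgs p l f (Function.update ω k false)| ≤ δ := by
  induction l with
  | nil => exact hf
  | cons i l ih => exact coinAvg_lipschitz h0 h1 ih i

/-- Exponential moment of a function of independent coins with bounded differences. -/
theorem coinAvgs_exp_le (h0 : ∀ i, 0 ≤ p i) (h1 : ∀ i, p i ≤ 1) {f : (ι → Bool) → ℝ} {δ : ι → ℝ}
    (l : List ι) (hδ : ∀ i ∈ l, δ i ≤ 1 ∨ p i = 1)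
    (hf : ∀ i ∈ l, ∀ ω, |f (Function.update ω i true) - f (Function.update ω i false)| ≤ δ i) :
    ∀ ω, coinAvgs p l (fun ω => Real.exp (f ω)) ω
      ≤ Real.exp (coinAvgs p l f ω + (l.map fun i => p i * (1 - p i) * δ i ^ 2).sum) := by
  induction l with
  | nil => intro ω; simp [coinAvgs]
  | cons i l ih =>
    intro ω
    have ih := ih (fun k hk => hδ k (List.mem_cons_of_mem _ hk))
      fun k hk => hf k (List.mem_cons_of_mem _ hk)
    set s := (l.map fun i => p i * (1 - p i) * δ i ^ 2).sum
    refine (coinAvg_mono h0 h1 ih i ω).trans ?_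
    have e : coinAvg p i (fun ω => Real.exp (coinAvgs p l f ω + s)) ω
        = coinAvg p i (fun ω => Real.exp (coinAvgs p l f ω)) ω * Real.exp s := by
      simp only [coinAvg, Real.exp_add]; ring
    rw [e]
    have := coinAvg_exp_le h0 h1 (hδ i List.mem_cons_self)
      (coinAvgs_lipschitz h0 h1 (hf i List.mem_cons_self) l) ω
    refine (mul_le_mul_of_nonneg_right this (Real.exp_pos s).le).trans (le_of_eq ?_)
    rw [← Real.exp_add, List.map_cons, List.sum_cons, coinAvgs, add_assoc]

/-! ### From coin averages to probabilities under the product law. -/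

variable (P : ι → unitInterval)

/-- Tossing one coin again independently does not change the law. With Fubini this makes averaging
over a coin preserve integrals. -/
theorem coinMeasure_map_update (i : ι) :
    ((coinMeasure P).prod (bernoulliMeasure true false (P i))).map
      (fun x => Function.update x.1 i x.2) = coinMeasure P := by
  have hm : Measurable fun x : (ι → Bool) × Bool => Function.update x.1 i x.2 := by
    refine measurable_pi_lambda _ fun k => ?_
    by_cases h : k = i
    · subst h; simpa using measurable_snd
    · simp only [Function.update_of_ne h]; fun_prop
  refine Measure.eq_infinitePi _ fun s t ht => ?_
  rw [Measure.map_apply hm (.pi s.countable_toSet fun i _ => ht i)]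
  by_cases hi : i ∈ s
  · have : (fun x : (ι → Bool) × Bool => Function.update x.1 i x.2) ⁻¹' (Set.pi s t)
        = (Set.pi (s.erase i : Finset ι) t) ×ˢ t i := by
      ext ⟨ω, b⟩
      simp only [Set.mem_preimage, Set.mem_pi, Finset.mem_coe, Set.mem_prod, Finset.mem_erase]
      constructor
      · intro h
        refine ⟨fun k hk => ?_, by simpa using h i hi⟩
        simpa [Function.update_of_ne hk.1] using h k hk.2
      · rintro ⟨h, hb⟩ k hk
        by_cases hki : k = i
        · subst hki; simpa using hb
        · simpa [Function.update_of_ne hki] using h k ⟨hki, hk⟩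
    rw [this, Measure.prod_prod, coinMeasure, Measure.infinitePi_pi _ fun i _ => ht i,
      Finset.prod_erase_mul _ _ hi]
  · have : (fun x : (ι → Bool) × Bool => Function.update x.1 i x.2) ⁻¹' (Set.pi s t)
        = (Set.pi s t) ×ˢ Set.univ := by
      ext ⟨ω, b⟩
      simp only [Set.mem_preimage, Set.mem_pi, Finset.mem_coe, Set.mem_prod, Set.mem_univ, and_true]
      refine forall₂_congr fun k hk => ?_
      rw [Function.update_of_ne (fun h : k = i => hi (h ▸ hk))]
    rw [this, Measure.prod_prod, coinMeasure, Measure.infinitePi_pi _ fun i _ => ht i]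
    simp

theorem measurable_coinAvg {f : (ι → Bool) → ℝ} (hf : Measurable f) (p : ι → ℝ) (i : ι) :
    Measurable (coinAvg p i f) := by
  have : ∀ b, Measurable fun ω : ι → Bool => Function.update ω i b := fun b => by
    refine measurable_pi_lambda _ fun k => ?_
    by_cases h : k = i
    · subst h; simp
    · simp only [Function.update_of_ne h]; fun_prop
  exact ((hf.comp (this true)).const_mul _).add ((hf.comp (this false)).const_mul _)

theorem measurable_coinAvgs {f : (ι → Bool) → ℝ} (hf : Measurable f) (p : ι → ℝ) (l : List ι) :
    Measurable (coinAvgs p l f) := by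
  induction l with
  | nil => exact hf
  | cons i l ih => exact measurable_coinAvg ih p i

theorem integral_coinAvg {f : (ι → Bool) → ℝ} (hf : Measurable f) (hb : ∀ ω, f ω ∈ Set.Icc 0 1)
    (i : ι) : ∫ ω, coinAvg (fun i => (P i : ℝ)) i f ω ∂coinMeasure P = ∫ ω, f ω ∂coinMeasure P := by
  have hm : Measurable fun x : (ι → Bool) × Bool => Function.update x.1 i x.2 := by
    refine measurable_pi_lambda _ fun k => ?_
    by_cases h : k = i
    · subst h; simpa using measurable_snd
    · simp only [Function.update_of_ne h]; fun_prop
  conv_rhs => rw [← coinMeasure_map_update P i]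
  rw [integral_map hm.aemeasurable hf.aestronglyMeasurable, integral_prod]
  · refine integral_congr_ae (ae_of_all _ fun ω => ?_)
    simp [coinAvg, integral_bernoulliMeasure]
  · refine Integrable.of_bound (hf.comp hm).aestronglyMeasurable 1 (ae_of_all _ fun x => ?_)
    rw [Real.norm_eq_abs, abs_of_nonneg (hb _).1]
    exact (hb _).2

theorem integral_coinAvgs {f : (ι → Bool) → ℝ} (hf : Measurable f) (hb : ∀ ω, f ω ∈ Set.Icc 0 1)
    (l : List ι) :
    ∫ ω, coinAvgs (fun i => (P i : ℝ)) l f ω ∂coinMeasure P = ∫ ω, f ω ∂coinMeasure P := by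
  have h0 : ∀ i, 0 ≤ (P i : ℝ) := fun i => (P i).2.1
  have h1 : ∀ i, (P i : ℝ) ≤ 1 := fun i => (P i).2.2
  induction l with
  | nil => rfl
  | cons i l ih =>
    rw [← ih]
    refine integral_coinAvg P (measurable_coinAvgs hf _ l) (fun ω => ⟨?_, ?_⟩) i
    · simpa [coinAvgs_const] using coinAvgs_mono h0 h1 (fun ω => (hb ω).1) l ω
    · simpa [coinAvgs_const] using coinAvgs_mono h0 h1 (fun ω => (hb ω).2) l ω

/-- This replaces conditioning: a bound that holds for the average over the coins of `l`, whatever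
the other coins show, survives integration over the latter. -/
theorem coinMeasure_real_le {B : Set (ι → Bool)} (hB : MeasurableSet B) (l : List ι) {δ : ℝ}
    (h : ∀ ω, coinAvgs (fun i => (P i : ℝ)) l (B.indicator 1) ω ≤ δ) :
    (coinMeasure P).real B ≤ δ := by
  have hm : Measurable (B.indicator (1 : (ι → Bool) → ℝ)) := measurable_one.indicator hB
  have hb : ∀ ω, B.indicator (1 : (ι → Bool) → ℝ) ω ∈ Set.Icc (0 : ℝ) 1 := fun ω => by
    by_cases hω : ω ∈ B <;> simp [hω]
  rw [← integral_indicator_one hB, ← integral_coinAvgs P hm hb l]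
  have h0 : ∀ i, 0 ≤ (P i : ℝ) := fun i => (P i).2.1
  have h1 : ∀ i, (P i : ℝ) ≤ 1 := fun i => (P i).2.2
  refine (integral_mono (integrable_coinMeasure_of_mem_Icc P (measurable_coinAvgs hm _ l)
    fun ω => ⟨?_, ?_⟩) (integrable_const δ) h).trans (by simp)
  · simpa [coinAvgs_const] using coinAvgs_mono h0 h1 (fun ω => (hb ω).1) l ω
  · simpa [coinAvgs_const] using coinAvgs_mono h0 h1 (fun ω => (hb ω).2) l ω

end CoinAverage

/-! ### Weights, phases and sampling probabilities. -/

section Parameters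

/-- The vanilla part starts when an iterated logarithm falls below this threshold. -/
noncomputable def vanillaThreshold (ε : ℝ) : ℝ := 1000 / (ε * Real.log (1 + ε))

variable {ε : ℝ}

theorem log_one_add_pos (hε : 0 < ε) : 0 < Real.log (1 + ε) := Real.log_pos (by linarith)

theorem log_one_add_le (hε : 0 < ε) : Real.log (1 + ε) ≤ ε := by
  have := Real.log_le_sub_one_of_pos (show 0 < 1 + ε by linarith)
  linarith

theorem thousand_div_sq_le_vanillaThreshold (hε : 0 < ε) :
    1000 / ε ^ 2 ≤ vanillaThreshold ε := by
  have := log_one_add_pos hε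
  have := log_one_add_le hε
  unfold vanillaThreshold
  rw [sq]
  gcongr

theorem thousand_le_vanillaThreshold (hε : 0 < ε) (hε' : ε ≤ 1) : 1000 ≤ vanillaThreshold ε := by
  refine le_trans ?_ (thousand_div_sq_le_vanillaThreshold hε)
  rw [le_div_iff₀ (by positivity)]
  nlinarith

variable {V : Type*} [Fintype V]

theorem iterLog_zero : iterLog V 0 = Fintype.card V := rfl

theorem iterLog_succ (i : ℕ) : iterLog V (i + 1) = Real.log (iterLog V i) :=
  Function.iterate_succ_apply' _ _ _

theorem exists_iterLog_mem_Ioc (hV : 1 < Fintype.card V) :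
    ∃ i, 1 ≤ i ∧ 0 < iterLog V i ∧ iterLog V i ≤ 1 ∧ ∀ k < i, 1 < iterLog V k := by
  have hex : ∃ i, iterLog V i ≤ 1 := by
    by_contra! hall
    -- Since log x ≤ x - 1, each iteration lowers the value by at least one.
    have hdec : ∀ i : ℕ, iterLog V i ≤ Fintype.card V - i := by
      intro i
      induction i with
      | zero => simp [iterLog_zero]
      | succ i ih =>
        have := Real.log_le_sub_one_of_pos (zero_lt_one.trans (hall i))
        rw [iterLog_succ]; push_cast; linarith
    have h1 := hdec (Fintype.card V)
    have h2 := hall (Fintype.card V)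
    simp only [sub_self] at h1
    linarith
  classical
  have hmin : ∀ k < Nat.find hex, 1 < iterLog V k := fun k hk => not_le.1 (Nat.find_min hex hk)
  refine ⟨Nat.find hex, ?_, ?_, Nat.find_spec hex, hmin⟩
  · rw [Nat.one_le_iff_ne_zero]
    intro h
    have := Nat.find_spec hex
    rw [h, iterLog_zero] at this
    have : Fintype.card V ≤ 1 := by exact_mod_cast this
    omega
  · rcases hk : Nat.find hex with _ | k
    · rw [iterLog_zero]; positivity
    · rw [iterLog_succ]
      exact Real.log_pos (hmin k (by omega))

theorem iterLog_anti {i : ℕ} (h : ∀ k < i, 1 < iterLog V k) {a b : ℕ} (hab : a ≤ b) (hb : b ≤ i) :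
    iterLog V b ≤ iterLog V a := by
  induction b, hab using Nat.le_induction with
  | base => exact le_rfl
  | succ b hab ih =>
    refine le_trans ?_ (ih (by omega))
    rw [iterLog_succ]
    have := Real.log_le_sub_one_of_pos (zero_lt_one.trans (h b (by omega)))
    linarith

variable [DecidableEq V] {G : SimpleGraph V} [DecidableRel G.Adj]

theorem one_lt_card_of_maxDegree_pos (hΔ : 0 < G.maxDegree) : 1 < Fintype.card V := by
  have hV : Nonempty V := by
    by_contra h
    rw [not_nonempty_iff] at h
    simp at hΔ
  have := G.maxDegree_lt_card_verts
  omega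

theorem weight_pos (hε : 0 < ε) (hΔ : 0 < G.maxDegree) (j : ℕ) : 0 < weight G ε j := by
  unfold weight; positivity

theorem weight_nonneg (hε : 0 < ε) (j : ℕ) : 0 ≤ weight G ε j := by
  unfold weight; positivity

theorem weight_mono (hε : 0 < ε) : Monotone (weight G ε) := by
  intro a b h
  unfold weight
  gcongr
  linarith

theorem weight_succ (j : ℕ) : weight G ε (j + 1) = (1 + ε) * weight G ε j := by
  unfold weight; ring

theorem weight_zero_le_one : weight G ε 0 ≤ 1 := by
  unfold weight
  rcases Nat.eq_zero_or_pos G.maxDegree with h | h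
  · simp [h]
  · rw [pow_zero, div_le_one (by exact_mod_cast h)]
    exact_mod_cast h

/-- A weight at most 1 makes the set defining the phase nonempty, so the infimum is attained. The
lower bound on the weight comes from minimality: the preceding index fails, and 1/(log^(i-1) n)^5 =
exp(-5 log^(i) n). -/
theorem phase_spec (hε : 0 < ε) (hΔ : 0 < G.maxDegree) {j : ℕ} (hw : weight G ε j ≤ 1) :
    1 ≤ phase G ε j ∧ 0 < iterLog V (phase G ε j) ∧
      weight G ε j ≤ 1 / iterLog V (phase G ε j) ^ 5 ∧
      (∀ k < phase G ε j, 1 < iterLog V k) ∧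
      Real.exp (-(5 * iterLog V (phase G ε j))) ≤ weight G ε j := by
  obtain ⟨i, hi1, hi0, hi2, hi3⟩ := exists_iterLog_mem_Ioc (one_lt_card_of_maxDegree_pos hΔ)
  have himem : i ∈ {i : ℕ | 1 ≤ i ∧ weight G ε j ≤ 1 / iterLog V i ^ 5} := by
    refine ⟨hi1, hw.trans ?_⟩
    rw [le_div_iff₀ (by positivity), one_mul]
    exact pow_le_one₀ hi0.le hi2
  have hmem : 1 ≤ phase G ε j ∧ weight G ε j ≤ 1 / iterLog V (phase G ε j) ^ 5 :=
    Nat.sInf_mem ⟨i, himem⟩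
  have hle : phase G ε j ≤ i := Nat.sInf_le himem
  have hk : ∀ k < phase G ε j, 1 < iterLog V k := fun k hk => hi3 k (hk.trans_le hle)
  have hwpos := weight_pos hε hΔ j
  have hpos : 0 < iterLog V (phase G ε j) := by
    have : 0 < 1 / iterLog V (phase G ε j) ^ 5 := hwpos.trans_le hmem.2
    have h5 : 0 < iterLog V (phase G ε j) ^ 5 := by simpa using this
    exact (Odd.pow_pos_iff (by decide)).mp h5
  refine ⟨hmem.1, hpos, hmem.2, hk, ?_⟩
  obtain ⟨i', hi'⟩ : ∃ i', phase G ε j = i' + 1 := ⟨phase G ε j - 1, by omega⟩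
  rw [hi'] at hk hpos ⊢
  have hprev := hk i' (by omega)
  have hexp : Real.exp (-(5 * iterLog V (i' + 1))) = 1 / iterLog V i' ^ 5 := by
    rw [iterLog_succ, Real.exp_neg, mul_comm, Real.exp_mul, Real.exp_log (by linarith), one_div]
    norm_cast
  rw [hexp]
  -- In phase 1 minimality says nothing, since index 0 is not a candidate; there Δ < n bounds the
  -- weight from below.
  rcases Nat.eq_zero_or_pos i' with rfl | h
  · rw [iterLog_zero] at hprev ⊢
    calc (1 : ℝ) / (Fintype.card V : ℝ) ^ 5 ≤ 1 / (Fintype.card V : ℝ) := by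
          apply one_div_le_one_div_of_le (by linarith)
          exact le_self_pow₀ hprev.le (by norm_num)
      _ ≤ weight G ε 0 := by
          unfold weight
          rw [pow_zero]
          apply one_div_le_one_div_of_le (by exact_mod_cast hΔ)
          have : Nonempty V := Fintype.card_pos_iff.1 (by
            have := one_lt_card_of_maxDegree_pos hΔ; omega)
          exact_mod_cast G.maxDegree_lt_card_verts.le
      _ ≤ weight G ε j := weight_mono hε (Nat.zero_le j)
  · by_contra! hlt
    have : phase G ε j ≤ i' := Nat.sInf_le ⟨h, hlt.le⟩
    omega

theorem isVanilla_mono {j k : ℕ} (h : j ≤ k) (hj : IsVanilla G ε j) : IsVanilla G ε k := by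
  obtain ⟨a, ha, h'⟩ := hj
  exact ⟨a, ha.trans h, h'⟩

theorem vanillaThreshold_le_of_weight_le_one (hε : 0 < ε) (hΔ : 0 < G.maxDegree)
    {j : ℕ} (hj : ¬ IsVanilla G ε j) (hw : weight G ε j ≤ 1) :
    vanillaThreshold ε ≤ iterLog V (phase G ε j) := by
  obtain ⟨_, hpos, _⟩ := phase_spec hε hΔ hw
  have hl := log_one_add_pos hε
  have : 1 / iterLog V (phase G ε j) ≤ ε * (Real.log (1 + ε) / 1000) := by
    by_contra! h
    exact hj ⟨j, le_rfl, h⟩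
  rw [div_le_iff₀ hpos] at this
  unfold vanillaThreshold
  rw [div_le_iff₀ (by positivity)]
  linarith

/-- The phase is meaningful only for weights at most 1, hence a bootstrap over the rounds: before
the vanilla part a weight at most 1 is in fact at most T^(-5) ≤ 1/2, with T the threshold, so the
next one is again at most 1. -/
theorem weight_le_of_not_isVanilla (hε : 0 < ε) (hε' : ε ≤ 1) (hΔ : 0 < G.maxDegree)
    {j : ℕ} (hj : ¬ IsVanilla G ε j) : weight G ε j ≤ 1 / vanillaThreshold ε ^ 5 := by
  have hT := thousand_le_vanillaThreshold hε hε'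
  have step : ∀ k ≤ j, weight G ε k ≤ 1 → weight G ε k ≤ 1 / vanillaThreshold ε ^ 5 := by
    intro k hk hw
    have h := vanillaThreshold_le_of_weight_le_one hε hΔ
      (fun h => hj (isVanilla_mono hk h)) hw
    refine (phase_spec hε hΔ hw).2.2.1.trans ?_
    gcongr
  have hT5 : 1 / vanillaThreshold ε ^ 5 ≤ 1 / 2 := by
    apply one_div_le_one_div_of_le (by norm_num)
    calc (2 : ℝ) ≤ 1000 := by norm_num
      _ ≤ vanillaThreshold ε := hT
      _ ≤ vanillaThreshold ε ^ 5 := le_self_pow₀ (by linarith) (by norm_num)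
  have all : ∀ k ≤ j, weight G ε k ≤ 1 / vanillaThreshold ε ^ 5 := by
    intro k
    induction k with
    | zero => exact fun h => step 0 h weight_zero_le_one
    | succ k ih =>
      intro h
      refine step _ h ?_
      have := ih (by omega)
      rw [weight_succ]
      have := weight_nonneg (G := G) hε k
      nlinarith
  exact all j le_rfl

theorem weight_le_one_of_not_isVanilla (hε : 0 < ε) (hε' : ε ≤ 1) (hΔ : 0 < G.maxDegree)
    {j : ℕ} (hj : ¬ IsVanilla G ε j) : weight G ε j ≤ 1 := by
  refine (weight_le_of_not_isVanilla hε hε' hΔ hj).trans ?_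
  have hT := thousand_le_vanillaThreshold hε hε'
  rw [div_le_one (by positivity)]
  exact one_le_pow₀ (by linarith)

theorem vanillaThreshold_le_iterLog_phase (hε : 0 < ε) (hε' : ε ≤ 1) (hΔ : 0 < G.maxDegree)
    {j : ℕ} (hj : ¬ IsVanilla G ε j) : vanillaThreshold ε ≤ iterLog V (phase G ε j) :=
  vanillaThreshold_le_of_weight_le_one hε hΔ hj (weight_le_one_of_not_isVanilla hε hε' hΔ hj)

theorem iterLog_phase_anti (hε : 0 < ε) (hε' : ε ≤ 1) (hΔ : 0 < G.maxDegree)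
    {h j : ℕ} (hj : ¬ IsVanilla G ε j) (hhj : h ≤ j) :
    iterLog V (phase G ε j) ≤ iterLog V (phase G ε h) := by
  obtain ⟨h1, h2, h3, h4, h5⟩ := phase_spec hε hΔ (weight_le_one_of_not_isVanilla hε hε' hΔ hj)
  refine iterLog_anti h4 (Nat.sInf_le ⟨h1, (weight_mono hε hhj).trans h3⟩) le_rfl

theorem iterLog_phase_le_log (hε : 0 < ε) (hε' : ε ≤ 1) (hΔ : 0 < G.maxDegree)
    {j : ℕ} (hj : ¬ IsVanilla G ε j) :
    iterLog V (phase G ε j) ≤ Real.log (Fintype.card V) := by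
  obtain ⟨h1, h2, h3, h4, h5⟩ := phase_spec hε hΔ (weight_le_one_of_not_isVanilla hε hε' hΔ hj)
  exact iterLog_anti h4 h1 le_rfl

theorem vanillaThreshold_le_log (hε : 0 < ε) (hε' : ε ≤ 1) (hΔ : 0 < G.maxDegree)
    {j : ℕ} (hj : ¬ IsVanilla G ε j) : vanillaThreshold ε ≤ Real.log (Fintype.card V) :=
  (vanillaThreshold_le_iterLog_phase hε hε' hΔ hj).trans (iterLog_phase_le_log hε hε' hΔ hj)

/-- Weights at most 1 give (1 + ε)^j ≤ Δ ≤ n, so j ≤ log n / log(1 + ε). The dependence on ε is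
absorbed by a second factor log n, which exceeds the vanilla threshold. -/
theorem add_one_le_log_sq (hε : 0 < ε) (hε' : ε ≤ 1) (hΔ : 0 < G.maxDegree)
    {j : ℕ} (hj : ¬ IsVanilla G ε j) : (j : ℝ) + 1 ≤ Real.log (Fintype.card V) ^ 2 := by
  have hT := vanillaThreshold_le_log hε hε' hΔ hj
  have hT' := thousand_le_vanillaThreshold hε hε'
  have hl := log_one_add_pos hε
  have hw := weight_le_one_of_not_isVanilla hε hε' hΔ hj
  unfold weight at hw
  rw [div_le_one (by exact_mod_cast hΔ)] at hw
  have hV : Nonempty V := Fintype.card_pos_iff.1 (by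
    have := one_lt_card_of_maxDegree_pos hΔ; omega)
  have hcard : (1 + ε) ^ j ≤ (Fintype.card V : ℝ) :=
    hw.trans (by exact_mod_cast G.maxDegree_lt_card_verts.le)
  have hlog := Real.log_le_log (by positivity) hcard
  rw [Real.log_pow] at hlog
  set L := Real.log (Fintype.card V)
  have hL : 1000 ≤ L := hT'.trans hT
  unfold vanillaThreshold at hT
  rw [div_le_iff₀ (by positivity)] at hT
  have h2 : (j : ℝ) * 1000 ≤ L ^ 2 := by
    calc (j : ℝ) * 1000 ≤ j * (L * (ε * Real.log (1 + ε))) := by gcongr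
      _ = (j * Real.log (1 + ε)) * L * ε := by ring
      _ ≤ L * L * 1 := by gcongr
      _ = L ^ 2 := by ring
  nlinarith

theorem sum_weight_le (hε : 0 < ε) (j : ℕ) :
    ∑ k ∈ Finset.range j, weight G ε k ≤ weight G ε j / ε := by
  induction j with
  | zero => simpa using div_nonneg (weight_nonneg hε 0) hε.le
  | succ j ih =>
    rw [Finset.sum_range_succ, weight_succ, one_add_mul, add_div, mul_div_cancel_left₀ _ hε.ne']
    linarith

theorem weightIncrement_nonneg (hε : 0 < ε) (h : ℕ) : 0 ≤ weightIncrement G ε h := by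
  cases h with
  | zero => exact weight_nonneg hε 0
  | succ h => exact sub_nonneg.2 (weight_mono hε (Nat.le_succ h))

theorem weightIncrement_le (hε : 0 < ε) (h : ℕ) : weightIncrement G ε h ≤ weight G ε h := by
  cases h with
  | zero => exact le_rfl
  | succ h => exact sub_le_self _ (weight_nonneg hε h)

theorem sum_weightIncrement (j : ℕ) :
    ∑ h ∈ Finset.range (j + 1), weightIncrement G ε h = weight G ε j := by
  induction j with
  | zero => simp [weightIncrement]
  | succ j ih => rw [Finset.sum_range_succ, ih, weightIncrement]; ring

variable {C : ℝ}

theorem samplingProb_coe (j : ℕ) :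
    (samplingProb G ε C j : ℝ) = max 0 (min 1 (C / iterLog V (phase G ε j) ^ 4)) := by
  rfl

theorem samplingProb_eq_min (hC : 1 ≤ C) (j : ℕ) :
    (samplingProb G ε C j : ℝ) = min 1 (C / iterLog V (phase G ε j) ^ 4) := by
  rw [samplingProb_coe]
  exact max_eq_right (le_min zero_le_one (by positivity))

theorem samplingProb_pos (hε : 0 < ε) (hε' : ε ≤ 1) (hΔ : 0 < G.maxDegree) (hC : 1 ≤ C)
    {j : ℕ} (hj : ¬ IsVanilla G ε j) : 0 < (samplingProb G ε C j : ℝ) := by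
  have := vanillaThreshold_le_iterLog_phase hε hε' hΔ hj
  have hT' := thousand_le_vanillaThreshold hε hε'
  rw [samplingProb_eq_min hC]
  have : 0 < iterLog V (phase G ε j) := by linarith
  exact lt_min one_pos (by positivity)

theorem one_le_log_pow_mul_samplingProb (hε : 0 < ε) (hε' : ε ≤ 1) (hΔ : 0 < G.maxDegree)
    (hC : 1 ≤ C) {j : ℕ} (hj : ¬ IsVanilla G ε j) :
    1 ≤ Real.log (Fintype.card V) ^ 4 * (samplingProb G ε C j : ℝ) := by
  have h1 := vanillaThreshold_le_iterLog_phase hε hε' hΔ hj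
  have h2 := iterLog_phase_le_log hε hε' hΔ hj
  have hT' := thousand_le_vanillaThreshold hε hε'
  set L := Real.log (Fintype.card V)
  set l := iterLog V (phase G ε j) with hl
  have hl0 : 0 < l := by linarith
  have hL : 1 ≤ L ^ 4 := one_le_pow₀ (by linarith)
  rw [samplingProb_eq_min hC, mul_min_of_nonneg _ _ (by positivity)]
  refine le_min (by linarith) ?_
  rw [← hl, ← mul_div_assoc, le_div_iff₀ (by positivity), one_mul]
  calc l ^ 4 ≤ L ^ 4 := by gcongr
    _ ≤ L ^ 4 * C := le_mul_of_one_le_right (by positivity) hC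

/-- The exponents 5 (phases) and 4 (probabilities) leave one logarithm: (1/l^5)/(C/l^4) = 1/(C l).
The logarithm of round `j` bounds that of every earlier round from below. -/
theorem weightIncrement_le_of_samplingProb_ne_one (hε : 0 < ε) (hε' : ε ≤ 1)
    (hΔ : 0 < G.maxDegree) (hC : 1 ≤ C) {h j : ℕ} (hj : ¬ IsVanilla G ε j) (hhj : h ≤ j)
    (hp : (samplingProb G ε C h : ℝ) ≠ 1) :
    weightIncrement G ε h / (samplingProb G ε C h : ℝ)
      ≤ 1 / (C * iterLog V (phase G ε j)) := by
  have hh : ¬ IsVanilla G ε h := fun h' => hj (isVanilla_mono hhj h')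
  have h1 := vanillaThreshold_le_iterLog_phase hε hε' hΔ hh
  have h1j := vanillaThreshold_le_iterLog_phase hε hε' hΔ hj
  have h2 := iterLog_phase_anti hε hε' hΔ hj hhj
  have hT' := thousand_le_vanillaThreshold hε hε'
  obtain ⟨_, _, hw, _⟩ := phase_spec hε hΔ (weight_le_one_of_not_isVanilla hε hε' hΔ hh)
  have hpe : (samplingProb G ε C h : ℝ) = C / iterLog V (phase G ε h) ^ 4 := by
    rw [samplingProb_eq_min hC] at hp ⊢
    rcases min_choice (1 : ℝ) (C / iterLog V (phase G ε h) ^ 4) with h' | h'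
    · exact absurd h' hp
    · exact h'
  rw [hpe]
  set l := iterLog V (phase G ε h)
  set l' := iterLog V (phase G ε j)
  have hl : 0 < l := by linarith
  calc weightIncrement G ε h / (C / l ^ 4) ≤ (1 / l ^ 5) / (C / l ^ 4) := by
        gcongr
        exact (weightIncrement_le hε h).trans hw
    _ = 1 / (C * l) := by field_simp
    _ ≤ 1 / (C * l') := by
        apply one_div_le_one_div_of_le
        · have : 0 < l' := by linarith
          positivity
        · gcongr

end Parameters

/-! ### Vertex covers and trimming of overfull nodes. -/

section Trimming

variable {V : Type*} [Fintype V] [DecidableEq V] {G : SimpleGraph V} [DecidableRel G.Adj]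

theorem sum_nodeValue (x : Sym2 V → ℝ) (S : Finset V) :
    ∑ v ∈ S, nodeValue G x v = ∑ e ∈ G.edgeFinset, ((S.filter (· ∈ e)).card : ℝ) * x e := by
  have h : ∀ v, nodeValue G x v = ∑ e ∈ G.edgeFinset, if v ∈ e then x e else 0 := by
    intro v
    rw [nodeValue, G.incidenceFinset_eq_filter, Finset.sum_filter]
  simp only [h]
  rw [Finset.sum_comm]
  refine Finset.sum_congr rfl fun e _ => ?_
  rw [← Finset.sum_filter, Finset.sum_const, nsmul_eq_mul]

theorem card_filter_mem_edge {e : Sym2 V} (he : e ∈ G.edgeFinset) :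
    (Finset.univ.filter (· ∈ e)).card = 2 := by
  have : Finset.univ.filter (· ∈ e) = e.toFinset := by ext v; simp
  rw [this]
  exact Sym2.card_toFinset_of_not_isDiag e (G.not_isDiag_of_mem_edgeFinset he)

theorem sum_univ_nodeValue (x : Sym2 V → ℝ) : ∑ v, nodeValue G x v = 2 * size G x := by
  rw [sum_nodeValue, size, Finset.mul_sum]
  refine Finset.sum_congr rfl fun e he => ?_
  rw [card_filter_mem_edge he]; norm_num

/-- Weak duality: each edge is counted at least once in the node values of a vertex cover. -/
theorem IsFractionalMatching.size_le_card {x : Sym2 V → ℝ} (hx : IsFractionalMatching G x)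
    {S : Finset V} (hS : ∀ e ∈ G.edgeSet, ∃ v ∈ S, v ∈ e) : size G x ≤ S.card := by
  calc size G x ≤ ∑ v ∈ S, nodeValue G x v := by
        rw [sum_nodeValue, size]
        refine Finset.sum_le_sum fun e he => ?_
        rw [SimpleGraph.mem_edgeFinset] at he
        obtain ⟨v, hv, hve⟩ := hS e he
        refine le_mul_of_one_le_left (hx.1 e he) ?_
        exact_mod_cast Finset.card_pos.2 ⟨v, Finset.mem_filter.2 ⟨hv, hve⟩⟩
    _ ≤ ∑ v ∈ S, 1 := Finset.sum_le_sum fun v _ => hx.2 v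
    _ = S.card := by simp

open Classical in
/-- The assignment that gives the value `0` to all edges incident to a node of value above `1`. -/
noncomputable def trim (G : SimpleGraph V) [DecidableRel G.Adj] (x : Sym2 V → ℝ) (e : Sym2 V) : ℝ :=
  if ∀ v ∈ e, nodeValue G x v ≤ 1 then x e else 0

theorem isFractionalMatching_trim {x : Sym2 V → ℝ} (hx : ∀ e ∈ G.edgeSet, 0 ≤ x e) :
    IsFractionalMatching G (trim G x) := by
  refine ⟨fun e he => ?_, fun v => ?_⟩
  · unfold trim; split_ifs
    · exact hx e he
    · exact le_rfl
  · by_cases hv : nodeValue G x v ≤ 1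
    · refine le_trans (Finset.sum_le_sum fun e he => ?_) hv
      unfold trim; split_ifs
      · exact le_rfl
      · exact hx e (G.mem_incidenceFinset v e |>.1 he).1
    · refine le_trans (le_of_eq (Finset.sum_eq_zero fun e he => ?_)) zero_le_one
      exact if_neg fun h => hv (h v (G.mem_incidenceFinset v e |>.1 he).2)

/-- Each erased edge is charged to an overfull endpoint. -/
theorem size_le_size_trim_add {x : Sym2 V → ℝ} (hx : ∀ e ∈ G.edgeSet, 0 ≤ x e) :
    size G x ≤ size G (trim G x)
      + ∑ v ∈ Finset.univ.filter (fun v => 1 < nodeValue G x v), nodeValue G x v := by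
  rw [sum_nodeValue, size, size, ← Finset.sum_add_distrib]
  refine Finset.sum_le_sum fun e he => ?_
  rw [SimpleGraph.mem_edgeFinset] at he
  have h0 := hx e he
  by_cases h : ∀ v ∈ e, nodeValue G x v ≤ 1
  · rw [trim, if_pos h]
    exact le_add_of_nonneg_right (by positivity)
  · rw [trim, if_neg h, zero_add]
    push Not at h
    obtain ⟨v, hve, hv⟩ := h
    refine le_mul_of_one_le_left h0 ?_
    exact_mod_cast Finset.card_pos.2 ⟨v, by simp [hv, hve]⟩

/-- Trimming turns any nonnegative assignment into a competitor of `M`; this is used for the values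
in the middle of an execution. -/
theorem sum_nodeValue_le_of_isMaxFractionalMatching {M x : Sym2 V → ℝ}
    (hM : IsMaxFractionalMatching G M) (hx : ∀ e ∈ G.edgeSet, 0 ≤ x e) :
    ∑ v, nodeValue G x v ≤ 2 * size G M
      + 2 * ∑ v ∈ Finset.univ.filter (fun v => 1 < nodeValue G x v), nodeValue G x v := by
  rw [sum_univ_nodeValue]
  have := size_le_size_trim_add hx
  have := hM.2 _ (isFractionalMatching_trim hx)
  linarith

end Trimming

/-! ### Deterministic analysis of one execution in terms of surpluses. -/

section Execution

variable {V : Type*} [Fintype V] [DecidableEq V] {G : SimpleGraph V} [DecidableRel G.Adj]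
  {ε C : ℝ} {ω : Coins V}

open Classical in
theorem run_succ (j : ℕ) (v : V) : run G ε C ω (j + 1) v =
    if run G ε C ω j v = ⊤ ∧ Freezes G ε C ω (run G ε C ω j) j v then (j : ℕ∞)
      else run G ε C ω j v := rfl

theorem run_succ_of_ne_top {j : ℕ} {v : V} (h : run G ε C ω j v ≠ ⊤) :
    run G ε C ω (j + 1) v = run G ε C ω j v := by
  rw [run_succ, if_neg fun h' => h h'.1]

theorem run_eq_of_ne_top {j k : ℕ} (hjk : j ≤ k) {v : V} (h : run G ε C ω j v ≠ ⊤) :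
    run G ε C ω k v = run G ε C ω j v := by
  induction k, hjk using Nat.le_induction with
  | base => rfl
  | succ k _ ih => rw [run_succ_of_ne_top (ih ▸ h), ih]

theorem run_eq_top_or_lt (j : ℕ) (v : V) : run G ε C ω j v = ⊤ ∨ run G ε C ω j v < j := by
  induction j with
  | zero => exact Or.inl rfl
  | succ j ih =>
    have hj : (j : ℕ∞) < ((j + 1 : ℕ) : ℕ∞) := by exact_mod_cast Nat.lt_succ_self j
    rw [run_succ]
    split_ifs with h
    · exact Or.inr hj
    · exact ih.imp_right fun h' => h'.trans hj

theorem le_run_of_eq_top {j : ℕ} {v : V} (h : run G ε C ω j v = ⊤) (k : ℕ) :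
    (j : ℕ∞) ≤ run G ε C ω (j + k) v := by
  induction k with
  | zero => rw [add_zero, h]; exact le_top
  | succ k ih =>
    rw [← add_assoc, run_succ]
    split_ifs
    · exact_mod_cast Nat.le_add_right j k
    · exact ih

theorem run_eq_top_iff {j : ℕ} {v : V} :
    run G ε C ω j v = ⊤ ↔ (j : ℕ∞) ≤ freezeRound G ε C ω v := by
  constructor
  · intro h
    refine le_iInf fun k => ?_
    rcases le_total k j with hk | hk
    · exact (le_top.trans h.ge).trans (run_antitone G ε C ω v hk)
    · obtain ⟨i, rfl⟩ := Nat.exists_eq_add_of_le hk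
      exact le_run_of_eq_top h i
  · intro h
    refine (run_eq_top_or_lt j v).resolve_right fun h' => ?_
    exact absurd (h.trans (iInf_le _ j)) (not_le.2 h')

theorem run_eq_freezeRound {j : ℕ} {v : V} (h : run G ε C ω j v ≠ ⊤) :
    run G ε C ω j v = freezeRound G ε C ω v := by
  refine le_antisymm (le_iInf fun k => ?_) (iInf_le _ j)
  rcases le_total k j with hk | hk
  · exact run_antitone G ε C ω v hk
  · exact (run_eq_of_ne_top hk h).ge

theorem freezes_of_freezeRound_eq {j : ℕ} {v : V} (h : freezeRound G ε C ω v = j) :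
    run G ε C ω j v = ⊤ ∧ Freezes G ε C ω (run G ε C ω j) j v := by
  have h1 : run G ε C ω j v = ⊤ := run_eq_top_iff.2 h.ge
  refine ⟨h1, ?_⟩
  by_contra hf
  have h2 : run G ε C ω (j + 1) v = ⊤ := by rw [run_succ, if_neg fun h' => hf h'.2, h1]
  have := run_eq_top_iff.1 h2
  rw [h] at this
  have : j + 1 ≤ j := by exact_mod_cast this
  omega

theorem not_freezes_of_lt_freezeRound {j : ℕ} {v : V} (h : (j : ℕ∞) < freezeRound G ε C ω v) :
    run G ε C ω j v = ⊤ ∧ ¬ Freezes G ε C ω (run G ε C ω j) j v := by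
  have h1 : run G ε C ω j v = ⊤ := run_eq_top_iff.2 h.le
  refine ⟨h1, fun hf => ?_⟩
  have h2 : run G ε C ω (j + 1) v = j := by rw [run_succ, if_pos ⟨h1, hf⟩]
  have h3 := run_eq_freezeRound (G := G) (ε := ε) (C := C) (ω := ω) (j := j + 1) (v := v)
    (by rw [h2]; exact ENat.natCast_ne_top j)
  rw [← h3, h2] at h
  exact lt_irrefl _ h

/-- The value that the edge `e` has at the beginning of round `j` in the state `κ`. -/
noncomputable def edgeLoad (G : SimpleGraph V) [DecidableRel G.Adj] (ε : ℝ) (κ : State V) (j : ℕ) :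
    Sym2 V → ℝ :=
  Sym2.lift ⟨fun u v => weight G ε (min (j : ℕ∞) (min (κ u) (κ v))).toNat,
    fun u v => by dsimp only; rw [min_comm (κ u)]⟩

/-- The value that the node `v` has at the beginning of round `j` in the state `κ`. -/
noncomputable def load (G : SimpleGraph V) [DecidableRel G.Adj] (ε : ℝ) (κ : State V) (j : ℕ)
    (v : V) : ℝ :=
  ∑ u ∈ G.neighborFinset v, weight G ε (min (j : ℕ∞) (min (κ v) (κ u))).toNat

theorem nodeValue_eq_sum_neighborFinset (x : Sym2 V → ℝ) (v : V) :
    nodeValue G x v = ∑ u ∈ G.neighborFinset v, x s(v, u) := by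
  rw [nodeValue]
  symm
  refine Finset.sum_bij (fun u _ => s(v, u)) ?_ ?_ ?_ ?_
  · intro u hu
    simpa [SimpleGraph.mem_incidenceFinset, SimpleGraph.mk'_mem_incidenceSet_iff] using hu
  · intro a _ b _ h
    exact Sym2.congr_right.1 h
  · intro e he
    rw [SimpleGraph.mem_incidenceFinset] at he
    obtain ⟨u, rfl⟩ := Sym2.mem_iff_exists.1 he.2
    exact ⟨u, by simpa using he.1, rfl⟩
  · intro u _; rfl

theorem nodeValue_edgeLoad (κ : State V) (j : ℕ) (v : V) :
    nodeValue G (edgeLoad G ε κ j) v = load G ε κ j v :=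
  nodeValue_eq_sum_neighborFinset _ _

theorem edgeLoad_nonneg (hε : 0 < ε) (κ : State V) (j : ℕ) (e : Sym2 V) :
    0 ≤ edgeLoad G ε κ j e := by
  induction e with | _ u v => exact weight_nonneg hε _

theorem load_nonneg (hε : 0 < ε) (κ : State V) (j : ℕ) (v : V) : 0 ≤ load G ε κ j v :=
  Finset.sum_nonneg fun _ _ => weight_nonneg hε _

theorem min_run (j : ℕ) (v : V) :
    min (j : ℕ∞) (run G ε C ω j v) = min (j : ℕ∞) (freezeRound G ε C ω v) := by
  by_cases h : run G ε C ω j v = ⊤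
  · rw [h, min_top_right, min_eq_left (run_eq_top_iff.1 h)]
  · rw [run_eq_freezeRound h]

/-- The state at the beginning of round `j` already contains all freezing rounds below `j`, and
values in round `j` see no others. So the deterministic argument may use the final freezing rounds,
and the probabilistic one the current state. -/
theorem load_run (j : ℕ) (v : V) :
    load G ε (run G ε C ω j) j v = load G ε (freezeRound G ε C ω) j v := by
  refine Finset.sum_congr rfl fun u _ => ?_
  have key : ∀ a b c : ℕ∞, min a (min b c) = min (min a b) (min a c) :=
    fun a b c => inf_inf_distrib_left a b c
  rw [key, min_run, min_run, ← key]

theorem trueValue_run {j : ℕ} {v : V} (h : run G ε C ω j v = ⊤) :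
    trueValue G ε (run G ε C ω j) j v = load G ε (freezeRound G ε C ω) j v := by
  rw [← load_run]
  refine Finset.sum_congr rfl fun u _ => ?_
  rw [h, min_top_left]
  rcases run_eq_top_or_lt (G := G) (ε := ε) (C := C) (ω := ω) j u with hu | hu
  · rw [if_pos hu, hu, min_top_right, ENat.toNat_natCast]
  · rw [if_neg hu.ne_top, min_eq_right hu.le]

theorem load_zero_le_one (κ : State V) (v : V) : load G ε κ 0 v ≤ 1 := by
  have : load G ε κ 0 v = G.degree v * weight G ε 0 := by simp [load]
  rw [this, weight, pow_zero, mul_one_div]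
  refine div_le_one_of_le₀ ?_ (by positivity)
  exact_mod_cast G.degree_le_maxDegree v

theorem load_succ_le (hε : 0 < ε) (κ : State V) (j : ℕ) (v : V) :
    load G ε κ (j + 1) v ≤ (1 + ε) * load G ε κ j v := by
  rw [load, load, Finset.mul_sum]
  refine Finset.sum_le_sum fun u _ => ?_
  rw [← weight_succ]
  refine weight_mono hε ?_
  generalize min (κ v) (κ u) = a
  induction a using ENat.recTopCoe with
  | top => rw [min_top_right, min_top_right, ENat.toNat_natCast, ENat.toNat_natCast]
  | coe a => 
    have h : ∀ b : ℕ, (min (b : ℕ∞) (a : ℕ∞)).toNat = min b a := fun b => by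
      rw [← (Nat.mono_cast (α := ℕ∞)).map_min, ENat.toNat_natCast]
    rw [h, h]; omega

theorem load_eq_of_le (κ : State V) {j k : ℕ} (hjk : j ≤ k) {v : V} (h : κ v ≤ j) :
    load G ε κ k v = load G ε κ j v := by
  refine Finset.sum_congr rfl fun u _ => ?_
  have h1 : min (κ v) (κ u) ≤ j := (min_le_left _ _).trans h
  rw [min_eq_right h1, min_eq_right (h1.trans (by exact_mod_cast hjk))]

/-- By how much the estimate of the value of `v` in round `j` misses the true value beyond the
tolerance `ε max (1, c_v)`. -/
noncomputable def surplus (G : SimpleGraph V) [DecidableRel G.Adj] (ε C : ℝ) (ω : Coins V)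
    (κ : State V) (j : ℕ) (v : V) : ℝ :=
  max 0 (|estimate G ε C ω κ j v - load G ε κ j v| - ε * max 1 (load G ε κ j v))

open Classical in
/-- The total surplus of the active nodes in round `j`. -/
noncomputable def totalSurplus (G : SimpleGraph V) [DecidableRel G.Adj] (ε C : ℝ) (ω : Coins V)
    (κ : State V) (j : ℕ) : ℝ :=
  ∑ v ∈ Finset.univ.filter (fun v => κ v = ⊤), surplus G ε C ω κ j v

theorem surplus_nonneg (κ : State V) (j : ℕ) (v : V) : 0 ≤ surplus G ε C ω κ j v := le_max_left _ _

/-- Go back to the last round in which `v` stayed active. It cannot be vanilla: there c_v < 1 - ε,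
and one growth step would leave the value below 1. -/
theorem exists_surplus_of_one_lt_load (hε : 0 < ε) (v : V) (j : ℕ)
    (h : 1 < load G ε (freezeRound G ε C ω) j v) :
    ∃ k < j, ¬ IsVanilla G ε k ∧ run G ε C ω k v = ⊤ ∧
      load G ε (freezeRound G ε C ω) j v
        ≤ (1 + ε) * load G ε (freezeRound G ε C ω) k v ∧
      estimate G ε C ω (run G ε C ω k) k v ≤ 1 - 10 * ε := by
  induction j with
  | zero => exact absurd (load_zero_le_one _ v) (not_le.2 h)
  | succ j ih =>
    rcases le_or_gt (freezeRound G ε C ω v) j with hj | hj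
    · rw [load_eq_of_le _ (Nat.le_succ j) hj] at h ⊢
      obtain ⟨k, hk, h'⟩ := ih h
      exact ⟨k, by omega, h'⟩
    · obtain ⟨htop, hf⟩ := not_freezes_of_lt_freezeRound hj
      have hle := load_succ_le (G := G) hε (freezeRound G ε C ω) j v
      simp only [Freezes, not_or, not_and, not_le, not_lt, ge_iff_le, gt_iff_lt] at hf
      have hnv : ¬ IsVanilla G ε j := by
        intro hv
        have := hf.1 hv
        rw [trueValue_run htop] at this
        nlinarith
      exact ⟨j, Nat.lt_succ_self j, hnv, htop, hle, hf.2 hnv⟩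

theorem load_le_surplus_of_one_lt_load (hε : 0 < ε) (hε' : ε ≤ 1 / 1000) (v : V) (j : ℕ)
    (h : 1 < load G ε (freezeRound G ε C ω) j v) :
    ∃ k < j, ¬ IsVanilla G ε k ∧ run G ε C ω k v = ⊤ ∧
      ε * load G ε (freezeRound G ε C ω) j v ≤ surplus G ε C ω (run G ε C ω k) k v := by
  obtain ⟨k, hk, hnv, htop, hle, hest⟩ := exists_surplus_of_one_lt_load hε v j h
  refine ⟨k, hk, hnv, htop, ?_⟩
  rw [surplus, load_run]
  refine le_trans ?_ (le_max_right _ _)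
  set c := load G ε (freezeRound G ε C ω) k v
  set t := estimate G ε C ω (run G ε C ω k) k v
  have h1 : c - t ≤ |t - c| := by rw [abs_sub_comm]; exact le_abs_self _
  -- The margin 10ε in the freezing rule pays for the growth step, the tolerance of the surplus and
  -- the claimed surplus.
  have hc : 1 - ε ≤ c := by nlinarith
  have h2 : ε * load G ε (freezeRound G ε C ω) j v ≤ ε * ((1 + ε) * c) := by gcongr
  rcases max_cases 1 c with ⟨hm, h3⟩ | ⟨hm, h3⟩ <;> rw [hm] <;> nlinarith

/-- The sampling rounds before round `j`. -/
noncomputable def samplingRounds (G : SimpleGraph V) [DecidableRel G.Adj] (ε : ℝ) (j : ℕ) :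
    Finset ℕ := by
  classical exact (Finset.range j).filter fun k => ¬ IsVanilla G ε k

theorem mem_samplingRounds {j k : ℕ} :
    k ∈ samplingRounds G ε j ↔ k < j ∧ ¬ IsVanilla G ε k := by
  simp [samplingRounds]

/-- If every node of `S` causes a surplus of at least `f v` in some sampling round, then the sum
of `f` over `S` is at most the sum of all surpluses. -/
theorem sum_le_sum_totalSurplus {S : Finset V} {f : V → ℝ} {j : ℕ}
    (h : ∀ v ∈ S, ∃ k < j, ¬ IsVanilla G ε k ∧ run G ε C ω k v = ⊤ ∧
      f v ≤ surplus G ε C ω (run G ε C ω k) k v) :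
    ∑ v ∈ S, f v ≤ ∑ k ∈ samplingRounds G ε j, totalSurplus G ε C ω (run G ε C ω k) k := by
  classical
  calc ∑ v ∈ S, f v ≤ ∑ v ∈ S, ∑ k ∈ samplingRounds G ε j,
        (if run G ε C ω k v = ⊤ then surplus G ε C ω (run G ε C ω k) k v else 0) := by
        refine Finset.sum_le_sum fun v hv => ?_
        obtain ⟨k, hk, hnv, htop, hf⟩ := h v hv
        refine hf.trans ?_
        have := Finset.single_le_sum (f := fun k => if run G ε C ω k v = ⊤ then
          surplus G ε C ω (run G ε C ω k) k v else 0) (s := samplingRounds G ε j)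
          (fun k _ => by split_ifs; exacts [surplus_nonneg _ _ _, le_rfl])
          (mem_samplingRounds.2 ⟨hk, hnv⟩)
        simpa [htop] using this
    _ = ∑ k ∈ samplingRounds G ε j, ∑ v ∈ S,
        (if run G ε C ω k v = ⊤ then surplus G ε C ω (run G ε C ω k) k v else 0) :=
        Finset.sum_comm
    _ ≤ _ := by
        refine Finset.sum_le_sum fun k _ => ?_
        rw [totalSurplus, Finset.sum_filter]
        refine Finset.sum_le_sum_of_subset_of_nonneg (Finset.subset_univ _) fun v _ _ => ?_
        split_ifs; exacts [surplus_nonneg _ _ _, le_rfl]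

theorem sum_load_of_one_lt_load (hε : 0 < ε) (hε' : ε ≤ 1 / 1000) (j : ℕ) :
    ε * ∑ v ∈ Finset.univ.filter (fun v => 1 < load G ε (freezeRound G ε C ω) j v),
      load G ε (freezeRound G ε C ω) j v
      ≤ ∑ k ∈ samplingRounds G ε j, totalSurplus G ε C ω (run G ε C ω k) k := by
  rw [Finset.mul_sum]
  refine sum_le_sum_totalSurplus fun v hv => ?_
  exact load_le_surplus_of_one_lt_load hε hε' v j (Finset.mem_filter.1 hv).2

/-- An estimate above 1 - 10ε at a value below 1 - 12ε errs by more than 2ε, of which the tolerance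
excuses ε. -/
theorem load_or_surplus_of_freezeRound_eq (hε : 0 < ε) {v : V} {k : ℕ}
    (h : freezeRound G ε C ω v = k) :
    1 - 12 * ε ≤ load G ε (freezeRound G ε C ω) k v ∨
      ¬ IsVanilla G ε k ∧ run G ε C ω k v = ⊤ ∧
        ε ≤ surplus G ε C ω (run G ε C ω k) k v := by
  obtain ⟨htop, hf⟩ := freezes_of_freezeRound_eq h
  rcases hf with ⟨_, hf⟩ | ⟨hnv, hf⟩
  · rw [trueValue_run htop] at hf
    left; linarith
  · by_cases hl : 1 - 12 * ε ≤ load G ε (freezeRound G ε C ω) k v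
    · exact Or.inl hl
    · refine Or.inr ⟨hnv, htop, ?_⟩
      push Not at hl
      rw [surplus, load_run, max_eq_left (a := (1 : ℝ)) (by linarith)]
      refine le_trans ?_ (le_max_right _ _)
      have := le_abs_self (estimate G ε C ω (run G ε C ω k) k v
        - load G ε (freezeRound G ε C ω) k v)
      linarith

/-- Only surpluses of rounds before `j` appear on the right, which makes the later induction on
rounds possible. -/
theorem sum_load_le {M : Sym2 V → ℝ} (hM : IsMaxFractionalMatching G M) (hε : 0 < ε)
    (hε' : ε ≤ 1 / 1000) (j : ℕ) :
    ε * ∑ v, load G ε (freezeRound G ε C ω) j v ≤ 2 * (ε * size G M)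
      + 2 * ∑ k ∈ samplingRounds G ε j, totalSurplus G ε C ω (run G ε C ω k) k := by
  have h1 := sum_nodeValue_le_of_isMaxFractionalMatching hM
    (x := edgeLoad G ε (freezeRound G ε C ω) j) fun e _ => edgeLoad_nonneg hε _ _ e
  simp only [nodeValue_edgeLoad] at h1
  have h2 := sum_load_of_one_lt_load (G := G) (C := C) (ω := ω) hε hε' j
  have := mul_le_mul_of_nonneg_left h1 hε.le
  linarith

/-- A round after which no node is frozen any more. -/
noncomputable def lastRound (G : SimpleGraph V) [DecidableRel G.Adj] (ε C : ℝ) (ω : Coins V) : ℕ :=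
  Finset.univ.sup fun v => (freezeRound G ε C ω v).toNat + 1

theorem lt_lastRound {v : V} {k : ℕ} (h : freezeRound G ε C ω v = k) :
    k < lastRound G ε C ω := by
  have := Finset.le_sup (f := fun v => (freezeRound G ε C ω v).toNat + 1) (Finset.mem_univ v)
  simp only [h, ENat.toNat_natCast] at this
  exact this

theorem exists_freezeRound_eq (hε : 0 < ε) (hε' : ε ≤ 1) {u v : V} (h : G.Adj u v) :
    ∃ k : ℕ, min (freezeRound G ε C ω u) (freezeRound G ε C ω v) = k := by
  have hb := bddAbove_activeRounds G hε hε' C ω (e := s(u, v)) h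
  by_contra! hne
  have htop : min (freezeRound G ε C ω u) (freezeRound G ε C ω v) = ⊤ := by
    by_contra h'
    obtain ⟨k, hk⟩ := ENat.ne_top_iff_exists.1 h'
    exact hne k hk.symm
  obtain ⟨m, hm⟩ := hb
  have := hm (a := m + 1) (by
    intro w hw
    rw [min_eq_top] at htop
    rcases Sym2.mem_iff.1 hw with rfl | rfl
    · rw [htop.1]; exact le_top
    · rw [htop.2]; exact le_top)
  omega

/-- The last common active round of the endpoints is the smaller of their freezing rounds, which is
finite by termination. -/
theorem edgeValue_eq_edgeLoad (hε : 0 < ε) (hε' : ε ≤ 1) {e : Sym2 V} (he : e ∈ G.edgeSet) :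
    edgeValue G ε C ω e = edgeLoad G ε (freezeRound G ε C ω) (lastRound G ε C ω) e := by
  induction e with | _ u v => ?_
  obtain ⟨k, hk⟩ := exists_freezeRound_eq (C := C) (ω := ω) hε hε' he
  have hset : {j : ℕ | ∀ w ∈ s(u, v), (j : ℕ∞) ≤ freezeRound G ε C ω w} = Set.Iic k := by
    ext j
    have : (j : ℕ∞) ≤ k ↔ j ≤ k := by norm_cast
    rw [Set.mem_Iic, ← this, ← hk]
    simp
  have hkJ : k ≤ lastRound G ε C ω := by
    rcases min_choice (freezeRound G ε C ω u) (freezeRound G ε C ω v) with h | h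
    · exact (lt_lastRound (h ▸ hk)).le
    · exact (lt_lastRound (h ▸ hk)).le
  simp only [edgeValue, edgeLoad, Sym2.lift_mk, hset, hk, csSup_Iic]
  rw [min_eq_right (by exact_mod_cast hkJ), ENat.toNat_natCast]

theorem nodeValue_edgeValue (hε : 0 < ε) (hε' : ε ≤ 1) (v : V) :
    nodeValue G (edgeValue G ε C ω) v
      = load G ε (freezeRound G ε C ω) (lastRound G ε C ω) v := by
  rw [← nodeValue_edgeLoad]
  refine Finset.sum_congr rfl fun e he => ?_
  exact edgeValue_eq_edgeLoad hε hε' (G.mem_incidenceFinset v e |>.1 he).1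

theorem output_eq_trim : output G ε C ω = trim G (edgeValue G ε C ω) := rfl

theorem edgeValue_nonneg (hε : 0 < ε) (e : Sym2 V) : 0 ≤ edgeValue G ε C ω e := weight_nonneg hε _

theorem isFractionalMatching_output (hε : 0 < ε) :
    IsFractionalMatching G (output G ε C ω) :=
  isFractionalMatching_trim fun e _ => edgeValue_nonneg hε e

/-- The approximation guarantee in an execution with a small total surplus. -/
theorem size_le_of_sum_totalSurplus_le (hε : 0 < ε) (hε' : ε ≤ 1 / 1000) {M : Sym2 V → ℝ}
    (hM : IsMaxFractionalMatching G M)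
    (h : ∑ k ∈ samplingRounds G ε (lastRound G ε C ω), totalSurplus G ε C ω (run G ε C ω k) k
      ≤ ε ^ 2 * size G M) :
    size G M ≤ (2 + 100 * ε) * size G (output G ε C ω) := by
  classical
  set J := lastRound G ε C ω
  set κ := freezeRound G ε C ω with hκ
  have hε1 : ε ≤ 1 := by linarith
  set F := Finset.univ.filter fun v => κ v ≠ ⊤
  set A := F.filter fun v => 1 - 12 * ε ≤ load G ε κ J v with hA
  set B := F.filter fun v => ¬ 1 - 12 * ε ≤ load G ε κ J v with hB
  -- By termination every edge has a frozen endpoint, so `F` is a vertex cover.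
  have hcover : size G M ≤ (F.card : ℝ) := by
    refine hM.1.size_le_card fun e he => ?_
    induction e with | _ u v => ?_
    obtain ⟨k, hk⟩ := exists_freezeRound_eq (C := C) (ω := ω) hε hε1 he
    rcases min_choice (freezeRound G ε C ω u) (freezeRound G ε C ω v) with h | h <;>
      rw [h] at hk
    · exact ⟨u, by simp [F, hκ, hk], by simp⟩
    · exact ⟨v, by simp [F, hκ, hk], by simp⟩
  have hcard : (F.card : ℝ) = A.card + B.card := by
    exact_mod_cast (Finset.card_filter_add_card_filter_not (s := F) _).symm
  have hBcard : ε * B.card ≤ ε ^ 2 * size G M := by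
    refine le_trans ?_ h
    have : ε * B.card = ∑ v ∈ B, ε := by rw [Finset.sum_const, nsmul_eq_mul, mul_comm]
    rw [this]
    refine sum_le_sum_totalSurplus fun v hv => ?_
    simp only [hB, F, Finset.mem_filter, Finset.mem_univ, true_and] at hv
    obtain ⟨k, hk⟩ := ENat.ne_top_iff_exists.1 hv.1
    have hkJ : k < J := lt_lastRound hk.symm
    rcases load_or_surplus_of_freezeRound_eq hε hk.symm with h' | h'
    · exact absurd (by rwa [load_eq_of_le κ hkJ.le hk.ge]) hv.2
    · exact ⟨k, hkJ, h'⟩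
  have hsum : ∑ v, load G ε κ J v = 2 * size G (edgeValue G ε C ω) := by
    rw [← sum_univ_nodeValue]
    exact Finset.sum_congr rfl fun v _ => (nodeValue_edgeValue hε hε1 v).symm
  have hAcard : (1 - 12 * ε) * A.card ≤ 2 * size G (edgeValue G ε C ω) := by
    rw [← hsum]
    have : (1 - 12 * ε) * A.card = ∑ v ∈ A, (1 - 12 * ε) := by
      rw [Finset.sum_const, nsmul_eq_mul, mul_comm]
    rw [this]
    refine (Finset.sum_le_sum fun v hv => (Finset.mem_filter.1 hv).2).trans ?_
    exact Finset.sum_le_sum_of_subset_of_nonneg (Finset.subset_univ _)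
      fun v _ _ => load_nonneg hε _ _ _
  have htrim := size_le_size_trim_add (G := G) (x := edgeValue G ε C ω)
    fun e _ => edgeValue_nonneg hε e
  simp only [nodeValue_edgeValue hε hε1, ← output_eq_trim] at htrim
  have hover := (sum_load_of_one_lt_load (G := G) (C := C) (ω := ω) hε hε' J).trans h
  set O := ∑ v ∈ Finset.univ.filter (fun v => 1 < load G ε κ J v), load G ε κ J v
  set m := size G M
  set s := size G (output G ε C ω)
  have h1 : (B.card : ℝ) ≤ ε * m := by
    have : ε * B.card ≤ ε * (ε * m) := by linarith
    exact le_of_mul_le_mul_left this hε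
  have h2 : O ≤ ε * m := by
    have : ε * O ≤ ε * (ε * m) := by linarith
    exact le_of_mul_le_mul_left this hε
  have hm0 : 0 ≤ m := Finset.sum_nonneg fun e he =>
    hM.1.1 e (SimpleGraph.mem_edgeFinset.1 he)
  have h3 : (1 - 12 * ε) * (m - ε * m) ≤ 2 * (s + ε * m) := by
    have : (1 - 12 * ε) * (m - ε * m) ≤ (1 - 12 * ε) * A.card :=
      mul_le_mul_of_nonneg_left (by linarith) (by linarith)
    linarith
  -- Uses (1 - 12ε)(1 - ε) - 2ε = 1 - 15ε + 12ε².
  have h4 : (1 - 15 * ε) * m ≤ 2 * s := by nlinarith [mul_nonneg (sq_nonneg ε) hm0]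
  have h5 : 1 ≤ (1 + 50 * ε) * (1 - 15 * ε) := by nlinarith
  calc m ≤ (1 + 50 * ε) * (1 - 15 * ε) * m := le_mul_of_one_le_left hm0 h5
    _ = (1 + 50 * ε) * ((1 - 15 * ε) * m) := by ring
    _ ≤ (1 + 50 * ε) * (2 * s) := by gcongr
    _ = _ := by ring

end Execution

/-! ### Moments and tails of one round for a fixed state. -/

section Concentration

variable {V : Type*} [Fintype V] [DecidableEq V] {G : SimpleGraph V} [DecidableRel G.Adj]
  {ε C : ℝ}

/-- The coins that decide the samples drawn in round `j`. -/
def roundCoins (V : Type*) [Fintype V] (j : ℕ) : Finset (ℕ × ℕ × V) :=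
  {j} ×ˢ (Finset.range (j + 1) ×ˢ Finset.univ)

theorem mem_roundCoins {j : ℕ} {q : ℕ × ℕ × V} : q ∈ roundCoins V j ↔ q.1 = j ∧ q.2.1 ≤ j := by
  obtain ⟨i, h, u⟩ := q
  simp [roundCoins, and_comm, eq_comm]

theorem sum_roundCoins (j : ℕ) (f : ℕ × ℕ × V → ℝ) :
    ((roundCoins V j).toList.map f).sum = ∑ h ∈ Finset.range (j + 1), ∑ u, f (j, h, u) := by
  rw [Finset.sum_map_toList, roundCoins, Finset.sum_product, Finset.sum_singleton,
    Finset.sum_product]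

/-- The probabilities of the coins. -/
noncomputable def coinProb (G : SimpleGraph V) [DecidableRel G.Adj] (ε C : ℝ)
    (q : ℕ × ℕ × V) : ℝ := samplingProb G ε C q.2.1

theorem coinProb_nonneg (q : ℕ × ℕ × V) : 0 ≤ coinProb G ε C q := (samplingProb G ε C q.2.1).2.1

theorem coinProb_le_one (q : ℕ × ℕ × V) : coinProb G ε C q ≤ 1 := (samplingProb G ε C q.2.1).2.2

open Classical in
/-- The part of the value of an active node `v` that is due to its neighbor `u` and round `h`. -/
noncomputable def share (G : SimpleGraph V) [DecidableRel G.Adj] (ε : ℝ) (κ : State V)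
    (v : V) (h : ℕ) (u : V) : ℝ :=
  if G.Adj v u ∧ (h : ℕ∞) ≤ κ u then weightIncrement G ε h else 0

variable {κ : State V}

theorem share_nonneg (hε : 0 < ε) (v : V) (h : ℕ) (u : V) : 0 ≤ share G ε κ v h u := by
  unfold share; split_ifs
  · exact weightIncrement_nonneg hε h
  · exact le_rfl

theorem share_le (hε : 0 < ε) (v : V) (h : ℕ) (u : V) :
    share G ε κ v h u ≤ weightIncrement G ε h := by
  unfold share; split_ifs
  · exact le_rfl
  · exact weightIncrement_nonneg hε h

/-- For a fixed state the estimate is linear in the coins of round `j`; unbiasedness and the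
influence of each coin are read off from this form. -/
theorem estimate_eq_sum_share (ω : Coins V) (j : ℕ) (v : V) :
    estimate G ε C ω κ j v = ∑ h ∈ Finset.range (j + 1), ∑ u,
      share G ε κ v h u * ((if ω (j, h, u) = true then 1 else 0) / samplingProb G ε C h) := by
  classical
  refine Finset.sum_congr rfl fun h _ => ?_
  rw [Finset.card_filter, Nat.cast_sum, Finset.sum_div, Finset.sum_mul,
    SimpleGraph.neighborFinset_eq_filter, Finset.sum_filter]
  refine Finset.sum_congr rfl fun u _ => ?_
  unfold share
  by_cases h1 : G.Adj v u <;> by_cases h2 : (h : ℕ∞) ≤ κ u <;> by_cases h3 : ω (j, h, u) = true <;>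
    simp [h1, h2, h3]
  ring

theorem sum_range_share (j : ℕ) (v u : V) :
    ∑ h ∈ Finset.range (j + 1), share G ε κ v h u
      = if G.Adj v u then weight G ε (min (j : ℕ∞) (κ u)).toNat else 0 := by
  classical
  split_ifs with hvu
  · simp only [share, hvu, true_and]
    rw [← Finset.sum_filter, ← sum_weightIncrement]
    refine Finset.sum_congr ?_ fun _ _ => rfl
    ext h
    simp only [Finset.mem_filter, Finset.mem_range, Nat.lt_succ_iff]
    generalize κ u = a
    induction a using ENat.recTopCoe with
    | top => simp
    | coe a =>
      rw [← (Nat.mono_cast (α := ℕ∞)).map_min, ENat.toNat_natCast, Nat.cast_le, le_min_iff]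
  · simp [share, hvu]

theorem load_eq_sum_share {v : V} (hv : κ v = ⊤) (j : ℕ) :
    load G ε κ j v = ∑ h ∈ Finset.range (j + 1), ∑ u, share G ε κ v h u := by
  rw [Finset.sum_comm, load, SimpleGraph.neighborFinset_eq_filter, Finset.sum_filter]
  refine Finset.sum_congr rfl fun u _ => ?_
  rw [sum_range_share, hv, min_top_left]

open Classical in
-- The roles of the endpoints are exchanged: what `u` contributes to its active neighbors telescopes
-- to the values of edges at `u`. This bounds the total influence of the coins of `u`.
theorem sum_share_le_load (hε : 0 < ε) (j : ℕ) (u : V) :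
    ∑ h ∈ Finset.range (j + 1), ∑ v ∈ Finset.univ.filter (fun v => κ v = ⊤), share G ε κ v h u
      ≤ load G ε κ j u := by
  rw [Finset.sum_comm, load, SimpleGraph.neighborFinset_eq_filter, Finset.sum_filter,
    Finset.sum_filter]
  refine Finset.sum_le_sum fun v _ => ?_
  rw [sum_range_share]
  simp only [G.adj_comm v u]
  have := weight_nonneg (G := G) hε
  split_ifs with h1 h2 h2
  · rw [h1, min_top_right]
  · exact le_rfl
  · exact this _
  · exact le_rfl

theorem estimate_update_sub (ω : Coins V) {j h : ℕ} (hh : h ≤ j) (u v : V) :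
    estimate G ε C (Function.update ω (j, h, u) true) κ j v
      - estimate G ε C (Function.update ω (j, h, u) false) κ j v
      = share G ε κ v h u / samplingProb G ε C h := by
  rw [estimate_eq_sum_share, estimate_eq_sum_share, ← Finset.sum_sub_distrib]
  simp only [← Finset.sum_sub_distrib]
  rw [Finset.sum_eq_single h, Finset.sum_eq_single u]
  · simp [div_eq_mul_inv]
  · intro u' _ hu'
    simp [hu']
  · simp
  · intro h' _ hh'
    refine Finset.sum_eq_zero fun u' _ => ?_
    simp [hh']
  · intro h'
    exact absurd (Finset.mem_range.2 (Nat.lt_succ_of_le hh)) h'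

theorem coinAvgs_estimate_sub_load (hε : 0 < ε) (hε' : ε ≤ 1) (hΔ : 0 < G.maxDegree)
    (hC : 1 ≤ C) {j : ℕ} (hj : ¬ IsVanilla G ε j) {v : V} (hv : κ v = ⊤) (ω : Coins V) :
    coinAvgs (coinProb G ε C) (roundCoins V j).toList
      (fun ω => estimate G ε C ω κ j v - load G ε κ j v) ω = 0 := by
  have e : (fun ω => estimate G ε C ω κ j v - load G ε κ j v) = fun ω =>
      ∑ h ∈ Finset.range (j + 1), ∑ u, share G ε κ v h u *
        ((if ω (j, h, u) = true then 1 else 0) / samplingProb G ε C h - 1) := by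
    funext ω
    rw [estimate_eq_sum_share, load_eq_sum_share hv, ← Finset.sum_sub_distrib]
    simp only [← Finset.sum_sub_distrib, mul_sub, mul_one]
  rw [e, coinAvgs_sum]
  refine Finset.sum_eq_zero fun h hh => ?_
  rw [coinAvgs_sum]
  refine Finset.sum_eq_zero fun u _ => ?_
  have hhj : h ≤ j := Nat.lt_succ_iff.1 (Finset.mem_range.1 hh)
  have hp := samplingProb_pos hε hε' hΔ hC (fun h' => hj (isVanilla_mono hhj h'))
  rw [coinAvgs_eval_eq_zero (p := coinProb G ε C) (i := (j, h, u)) (fun b => share G ε κ v h u *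
    ((if b = true then 1 else 0) / samplingProb G ε C h - 1))]
  · simp only [coinProb, if_true, Bool.false_eq_true, if_false]
    field_simp
    ring
  · rw [Finset.mem_toList, mem_roundCoins]; exact ⟨rfl, hhj⟩

/-- Exponential moments of the error of an estimate. -/
theorem coinAvgs_exp_estimate_le (hε : 0 < ε) (hε' : ε ≤ 1) (hΔ : 0 < G.maxDegree)
    (hC : 1 ≤ C) {j : ℕ} (hj : ¬ IsVanilla G ε j) {v : V} (hv : κ v = ⊤) {θ : ℝ}
    (hθ : |θ| ≤ C * iterLog V (phase G ε j)) (ω : Coins V) :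
    coinAvgs (coinProb G ε C) (roundCoins V j).toList
      (fun ω => Real.exp (θ * (estimate G ε C ω κ j v - load G ε κ j v))) ω
      ≤ Real.exp (θ ^ 2 * (1 / (C * iterLog V (phase G ε j))) * load G ε κ j v) := by
  set B := C * iterLog V (phase G ε j) with hBdef
  have hB : 0 < B := by
    have := vanillaThreshold_le_iterLog_phase hε hε' hΔ hj
    have := thousand_le_vanillaThreshold hε hε'
    have : 0 < iterLog V (phase G ε j) := by linarith
    positivity
  have hb : ∀ h ≤ j, ∀ u, (samplingProb G ε C h : ℝ) ≠ 1 →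
      share G ε κ v h u / samplingProb G ε C h ≤ 1 / B := fun h hh u hp =>
    (div_le_div_of_nonneg_right (share_le hε v h u) (samplingProb G ε C h).2.1).trans
      (weightIncrement_le_of_samplingProb_ne_one hε hε' hΔ hC hj hh hp)
  refine (coinAvgs_exp_le (fun q => coinProb_nonneg q) (fun q => coinProb_le_one q)
    (δ := fun q => |θ| * (share G ε κ v q.2.1 q.2.2 / samplingProb G ε C q.2.1)) _ ?_ ?_ ω).trans ?_
  · rintro ⟨i, h, u⟩ hq
    rw [Finset.mem_toList, mem_roundCoins] at hq
    obtain ⟨rfl, hh⟩ := hq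
    by_cases hp : (samplingProb G ε C h : ℝ) = 1
    · exact Or.inr hp
    · left
      calc |θ| * (share G ε κ v h u / samplingProb G ε C h) ≤ B * (1 / B) :=
            mul_le_mul hθ (hb h hh u hp)
              (div_nonneg (share_nonneg hε v h u) (samplingProb G ε C h).2.1) hB.le
        _ = 1 := by field_simp
  · rintro ⟨i, h, u⟩ hq ω
    rw [Finset.mem_toList, mem_roundCoins] at hq
    obtain ⟨rfl, hh⟩ := hq
    rw [← mul_sub, sub_sub_sub_cancel_right, estimate_update_sub ω hh, abs_mul, abs_of_nonneg
      (div_nonneg (share_nonneg hε v h u) (samplingProb G ε C h).2.1)]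
  · have hzero := coinAvgs_estimate_sub_load hε hε' hΔ hC hj hv ω
    rw [coinAvgs_const_mul]
    beta_reduce
    rw [hzero, mul_zero, zero_add, sum_roundCoins, load_eq_sum_share hv, Finset.mul_sum]
    refine Real.exp_le_exp.2 (Finset.sum_le_sum fun h hh => ?_)
    rw [Finset.mul_sum]
    refine Finset.sum_le_sum fun u _ => ?_
    have hhj : h ≤ j := Nat.lt_succ_iff.1 (Finset.mem_range.1 hh)
    have hp := samplingProb_pos hε hε' hΔ hC (fun h' => hj (isVanilla_mono hhj h'))
    have hs := share_nonneg (G := G) (κ := κ) hε v h u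
    simp only [coinProb]
    by_cases hp1 : (samplingProb G ε C h : ℝ) = 1
    · rw [hp1]; simp only [sub_self, mul_zero, zero_mul]; positivity
    · have hle := hb h hhj u hp1
      set P := (samplingProb G ε C h : ℝ)
      have hP1 : P ≤ 1 := (samplingProb G ε C h).2.2
      -- One factor share/P is bounded by 1/B and the other share is kept, so that the variance is
      -- proportional to the value of `v`.
      calc P * (1 - P) * (|θ| * (share G ε κ v h u / P)) ^ 2
          = θ ^ 2 * (share G ε κ v h u / P) * share G ε κ v h u * (1 - P) := by
            rw [mul_pow, sq_abs]; field_simp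
        _ ≤ θ ^ 2 * (share G ε κ v h u / P) * share G ε κ v h u * 1 := by
            gcongr; linarith
        _ ≤ θ ^ 2 * (1 / B) * share G ε κ v h u := by rw [mul_one]; gcongr

/-- The comparison function is a multiple of cosh(l x) - 1, which vanishes at 0. So the expected
surplus will be proportional to c_v, and its sum over nodes is controlled by |M*| rather than by n.
-/
theorem max_zero_abs_sub_le {l t x : ℝ} (hl : 0 < l) (ht : 4 ≤ Real.exp (l * t)) :
    max 0 (|x| - t) ≤ 4 / l * Real.exp (-(l * t))
      * ((1 / 2) * (Real.exp (l * x) + Real.exp (-l * x)) - 1) := by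
  have hc : (1 / 2) * (Real.exp (l * x) + Real.exp (-l * x)) = Real.cosh (l * |x|) := by
    have : Real.cosh (l * |x|) = Real.cosh (l * x) := by
      rw [← Real.cosh_abs (l * x), abs_mul, abs_of_pos hl]
    rw [this, Real.cosh_eq, neg_mul]; ring
  rw [hc]
  have h1 := Real.one_le_cosh (l * |x|)
  refine max_le (mul_nonneg (by positivity) (by linarith)) ?_
  rcases le_total |x| t with hx | hx
  · exact (sub_nonpos.2 hx).trans (mul_nonneg (by positivity) (by linarith))
  · have h2 : Real.exp (l * |x|) / 4 ≤ Real.cosh (l * |x|) - 1 := by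
      have : Real.exp (l * t) ≤ Real.exp (l * |x|) := Real.exp_le_exp.2 (by gcongr)
      rw [Real.cosh_eq]
      have := Real.exp_pos (-(l * |x|))
      linarith
    calc |x| - t ≤ Real.exp (l * (|x| - t)) / l := by
          rw [le_div_iff₀ hl]
          have := Real.add_one_le_exp (l * (|x| - t))
          linarith
      _ = 4 / l * Real.exp (-(l * t)) * (Real.exp (l * |x|) / 4) := by
          have : l * (|x| - t) = -(l * t) + l * |x| := by ring
          rw [this, Real.exp_add]; field_simp
      _ ≤ _ := by gcongr

theorem exp_sub_one_le_mul_exp (y : ℝ) : Real.exp y - 1 ≤ y * Real.exp y := by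
  have h := mul_le_mul_of_nonneg_right (Real.add_one_le_exp (-y)) (Real.exp_pos y).le
  rw [← Real.exp_add, neg_add_cancel, Real.exp_zero] at h
  linarith

/-- The expected surplus of an active node. -/
theorem coinAvgs_surplus_le (hε : 0 < ε) (hε' : ε ≤ 1) (hΔ : 0 < G.maxDegree)
    (hC : 1 ≤ C) (hC' : 20 / ε ^ 2 ≤ C) {j : ℕ} (hj : ¬ IsVanilla G ε j) {v : V} (hv : κ v = ⊤)
    (ω : Coins V) :
    coinAvgs (coinProb G ε C) (roundCoins V j).toList
      (fun ω => surplus G ε C ω κ j v) ω ≤ 2 * ε * weight G ε j * load G ε κ j v := by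
  have hell := vanillaThreshold_le_iterLog_phase hε hε' hΔ hj
  have hT := thousand_le_vanillaThreshold hε hε'
  have hw := (phase_spec hε hΔ (weight_le_one_of_not_isVanilla hε hε' hΔ hj)).2.2.2.2
  have hmgf := fun θ hθ => coinAvgs_exp_estimate_le hε hε' hΔ hC hj hv (θ := θ) hθ ω
  set ell := iterLog V (phase G ε j)
  have hell0 : 0 < ell := by linarith
  set B := C * ell
  have hB : 0 < B := by positivity
  set c := load G ε κ j v with hc
  have hc0 : 0 ≤ c := load_nonneg hε _ _ _
  -- With this l the variance exponent y is at most half of l t, and C ≥ 20/ε² gives l t ≥ 10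
  -- log^(i) n. The remaining exponent is thus at most -5 log^(i) n, matching the lower bound on the
  -- weight.
  set l := ε * B / 2 with hl
  have hl0 : 0 < l := by positivity
  have hlB : l ≤ B := by rw [hl]; nlinarith
  set t := ε * max 1 c with ht
  have hεB : 20 * ell ≤ ε ^ 2 * B := by
    rw [div_le_iff₀ (by positivity)] at hC'
    calc 20 * ell ≤ C * ε ^ 2 * ell := by gcongr
      _ = ε ^ 2 * B := by ring
  have hlt : l * t = ε ^ 2 * B / 2 * max 1 c := by rw [hl, ht]; ring
  have hlt' : 10 * ell ≤ l * t := by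
    rw [hlt]
    calc 10 * ell ≤ ε ^ 2 * B / 2 := by linarith
      _ ≤ _ := le_mul_of_one_le_right (by positivity) (le_max_left _ _)
  have h4 : 4 ≤ Real.exp (l * t) := by
    have := Real.add_one_le_exp (l * t)
    linarith
  refine (coinAvgs_mono (fun q => coinProb_nonneg q) (fun q => coinProb_le_one q)
    (fun ω' => max_zero_abs_sub_le (x := estimate G ε C ω' κ j v - load G ε κ j v) hl0 h4)
    _ ω).trans ?_
  rw [coinAvgs_const_mul]
  simp only [sub_eq_add_neg _ (1 : ℝ)]
  rw [coinAvgs_add, coinAvgs_const_mul, coinAvgs_add, coinAvgs_const]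
  have m1 := hmgf l (by rwa [abs_of_pos hl0])
  have m2 := hmgf (-l) (by rwa [abs_neg, abs_of_pos hl0])
  rw [neg_sq] at m2
  set y := l ^ 2 * (1 / B) * c with hy
  have hyt : y ≤ l * t / 2 := by
    have : y = ε ^ 2 * B / 4 * c := by rw [hy, hl]; field_simp; ring
    rw [this, hlt]
    have : ε ^ 2 * B / 4 * c ≤ ε ^ 2 * B / 4 * max 1 c := by gcongr; exact le_max_right _ _
    linarith
  calc _ ≤ 4 / l * Real.exp (-(l * t)) * (y * Real.exp y) := by
        have := exp_sub_one_le_mul_exp y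
        gcongr
        linarith
    _ = 4 / l * y * Real.exp (-(l * t) + y) := by rw [Real.exp_add]; ring
    _ = 2 * ε * c * Real.exp (-(l * t) + y) := by
        congr 1; rw [hy, hl]; field_simp; ring
    _ ≤ 2 * ε * c * Real.exp (-(5 * ell)) := by
        gcongr; linarith
    _ ≤ 2 * ε * c * weight G ε j := by gcongr
    _ = _ := by ring

theorem coinAvgs_totalSurplus_le (hε : 0 < ε) (hε' : ε ≤ 1) (hΔ : 0 < G.maxDegree)
    (hC : 1 ≤ C) (hC' : 20 / ε ^ 2 ≤ C) {j : ℕ} (hj : ¬ IsVanilla G ε j) (ω : Coins V) :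
    coinAvgs (coinProb G ε C) (roundCoins V j).toList
      (fun ω => totalSurplus G ε C ω κ j) ω ≤ 2 * ε * weight G ε j * ∑ v, load G ε κ j v := by
  classical
  have e : (fun ω => totalSurplus G ε C ω κ j) = fun ω =>
      ∑ v ∈ Finset.univ.filter (fun v => κ v = ⊤), surplus G ε C ω κ j v := by
    funext ω; unfold totalSurplus; congr
  rw [e, coinAvgs_sum, Finset.mul_sum]
  refine (Finset.sum_le_sum fun v hv =>
    coinAvgs_surplus_le hε hε' hΔ hC hC' hj (Finset.mem_filter.1 hv).2 ω).trans ?_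
  refine Finset.sum_le_sum_of_subset_of_nonneg (Finset.subset_univ _) fun v _ _ => ?_
  have := load_nonneg (G := G) hε κ j v
  have := weight_nonneg (G := G) hε j
  positivity

theorem abs_surplus_sub_le (ω ω' : Coins V) (j : ℕ) (v : V) :
    |surplus G ε C ω κ j v - surplus G ε C ω' κ j v|
      ≤ |estimate G ε C ω κ j v - estimate G ε C ω' κ j v| := by
  unfold surplus
  refine (abs_max_sub_max_le_max _ _ _ _).trans ?_
  rw [sub_self, abs_zero, sub_sub_sub_cancel_right]
  refine max_le (abs_nonneg _) ((abs_abs_sub_abs_le _ _).trans (le_of_eq ?_))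
  rw [sub_sub_sub_cancel_right]

open Classical in
-- The surplus is 1-Lipschitz in the estimate, and a coin of `u` enters the estimates of all active
-- neighbors of `u`.
theorem abs_totalSurplus_update_sub_le (hε : 0 < ε) (ω : Coins V) {j h : ℕ} (hh : h ≤ j) (u : V) :
    |totalSurplus G ε C (Function.update ω (j, h, u) true) κ j
      - totalSurplus G ε C (Function.update ω (j, h, u) false) κ j|
      ≤ (∑ v ∈ Finset.univ.filter (fun v => κ v = ⊤), share G ε κ v h u) / samplingProb G ε C h := by
  unfold totalSurplus
  rw [← Finset.sum_sub_distrib, Finset.sum_div]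
  refine (Finset.abs_sum_le_sum_abs _ _).trans (Finset.sum_le_sum fun v _ => ?_)
  refine (abs_surplus_sub_le _ _ j v).trans (le_of_eq ?_)
  rw [estimate_update_sub ω hh, abs_of_nonneg
      (div_nonneg (share_nonneg hε v h u) (samplingProb G ε C h).2.1)]

/-- Concentration of the total surplus of a round. -/
theorem coinAvgs_exp_totalSurplus_le (hε : 0 < ε) (hε' : ε ≤ 1) (hΔ : 0 < G.maxDegree)
    (hC : 1 ≤ C) {j : ℕ} (hj : ¬ IsVanilla G ε j) {L θ S : ℝ}
    (hL : L = Real.log (Fintype.card V)) (hload : ∀ u, load G ε κ j u ≤ L)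
    (hS : ∑ u, load G ε κ j u ≤ S) (hθ : 0 ≤ θ) (hθ' : θ * L ^ 5 ≤ 1) (ω : Coins V) :
    coinAvgs (coinProb G ε C) (roundCoins V j).toList
      (fun ω => Real.exp (θ * totalSurplus G ε C ω κ j)) ω
      ≤ Real.exp (θ * coinAvgs (coinProb G ε C) (roundCoins V j).toList
          (fun ω => totalSurplus G ε C ω κ j) ω + θ ^ 2 * L ^ 9 * S) := by
  classical
  have hL0 : 0 ≤ L := by
    have := vanillaThreshold_le_log hε hε' hΔ hj
    have := thousand_le_vanillaThreshold hε hε'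
    linarith
  set E : ℕ → V → ℝ := fun h u =>
    ∑ v ∈ Finset.univ.filter (fun v => κ v = ⊤), share G ε κ v h u with hE
  have hE0 : ∀ h u, 0 ≤ E h u := fun h u => Finset.sum_nonneg fun v _ => share_nonneg hε v h u
  have hEsum : ∀ u, ∑ h ∈ Finset.range (j + 1), E h u ≤ load G ε κ j u :=
    fun u => sum_share_le_load hε j u
  have hEle : ∀ h ≤ j, ∀ u, E h u ≤ load G ε κ j u := fun h hh u =>
    (Finset.single_le_sum (f := fun h => E h u) (fun h _ => hE0 h u)
      (Finset.mem_range.2 (Nat.lt_succ_of_le hh))).trans (hEsum u)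
  have hdiv : ∀ h ≤ j, ∀ u, E h u / samplingProb G ε C h ≤ L ^ 4 * E h u := fun h hh u => by
    have hnv : ¬ IsVanilla G ε h := fun h' => hj (isVanilla_mono hh h')
    rw [div_le_iff₀ (samplingProb_pos hε hε' hΔ hC hnv)]
    have := one_le_log_pow_mul_samplingProb hε hε' hΔ hC hnv
    rw [← hL] at this
    have := mul_le_mul_of_nonneg_right this (hE0 h u)
    linarith
  refine (coinAvgs_exp_le (fun q => coinProb_nonneg q) (fun q => coinProb_le_one q)
    (δ := fun q => θ * (L ^ 4 * E q.2.1 q.2.2)) _ ?_ ?_ ω).trans ?_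
  · rintro ⟨i, h, u⟩ hq
    rw [Finset.mem_toList, mem_roundCoins] at hq
    obtain ⟨rfl, hh⟩ := hq
    left
    calc θ * (L ^ 4 * E h u) ≤ θ * (L ^ 4 * L) := by
          gcongr; exact (hEle h hh u).trans (hload u)
      _ = θ * L ^ 5 := by ring
      _ ≤ 1 := hθ'
  · rintro ⟨i, h, u⟩ hq ω
    rw [Finset.mem_toList, mem_roundCoins] at hq
    obtain ⟨rfl, hh⟩ := hq
    rw [← mul_sub, abs_mul, abs_of_nonneg hθ]
    exact mul_le_mul_of_nonneg_left
      ((abs_totalSurplus_update_sub_le hε ω hh u).trans (hdiv h hh u)) hθ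
  · rw [coinAvgs_const_mul, sum_roundCoins]
    refine Real.exp_le_exp.2 (add_le_add_right ?_ _)
    rw [Finset.sum_comm]
    calc ∑ u, ∑ h ∈ Finset.range (j + 1), coinProb G ε C (j, h, u) * (1 - coinProb G ε C (j, h, u))
          * (θ * (L ^ 4 * E h u)) ^ 2
        ≤ ∑ u, ∑ h ∈ Finset.range (j + 1), θ ^ 2 * L ^ 8 * (L * E h u) := by
          refine Finset.sum_le_sum fun u _ => Finset.sum_le_sum fun h hh => ?_
          have hh : h ≤ j := Nat.lt_succ_iff.1 (Finset.mem_range.1 hh)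
          have p0 := coinProb_nonneg (G := G) (ε := ε) (C := C) (j, h, u)
          have p1 := coinProb_le_one (G := G) (ε := ε) (C := C) (j, h, u)
          have := hE0 h u
          have hle : E h u ≤ L := (hEle h hh u).trans (hload u)
          calc _ ≤ 1 * (θ * (L ^ 4 * E h u)) ^ 2 := by gcongr; nlinarith
            _ = θ ^ 2 * L ^ 8 * (E h u * E h u) := by ring
            _ ≤ _ := by gcongr
      _ = θ ^ 2 * L ^ 9 * ∑ u, ∑ h ∈ Finset.range (j + 1), E h u := by
          simp only [Finset.mul_sum]
          refine Finset.sum_congr rfl fun u _ => Finset.sum_congr rfl fun h _ => by ring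
      _ ≤ θ ^ 2 * L ^ 9 * S := by
          gcongr
          exact (Finset.sum_le_sum fun u _ => hEsum u).trans hS

open Classical in
theorem coinAvgs_totalSurplus_tail (hε : 0 < ε) (hε' : ε ≤ 1) (hΔ : 0 < G.maxDegree)
    (hC : 1 ≤ C) (hC' : 20 / ε ^ 2 ≤ C) {j : ℕ} (hj : ¬ IsVanilla G ε j) {L m : ℝ}
    (hL : L = Real.log (Fintype.card V)) (hload : ∀ u, load G ε κ j u ≤ L)
    (hm : ∑ u, load G ε κ j u ≤ 5 * m) (hmL : 200 * L ^ 18 ≤ m) (ω : Coins V) :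
    coinAvgs (coinProb G ε C) (roundCoins V j).toList
      (fun ω => if 10 * ε * m * weight G ε j + m / L ^ 4 < totalSurplus G ε C ω κ j then 1 else 0) ω
      ≤ Real.exp (-(10 * L)) := by
  have hL1 : 1000 ≤ L := by
    have := vanillaThreshold_le_log hε hε' hΔ hj
    have := thousand_le_vanillaThreshold hε hε'
    linarith
  have hL0 : 0 < L := by linarith
  set t := 10 * ε * m * weight G ε j + m / L ^ 4 with ht
  -- The gain θ m/L^4 = m/(10 L^17) is twice the variance term 5θ² L^9 m = m/(20 L^17); what is left
  -- reaches 10 L exactly when m ≥ 200 L^18.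
  set θ := 1 / (10 * L ^ 13) with hθ
  have hθ0 : 0 < θ := by positivity
  have hθ1 : θ * L ^ 5 ≤ 1 := by
    rw [hθ, one_div_mul_eq_div, div_le_one (by positivity)]
    have : L ^ 5 ≤ L ^ 13 := pow_le_pow_right₀ (by linarith) (by norm_num)
    have : 0 < L ^ 13 := by positivity
    linarith
  have hexp := coinAvgs_exp_totalSurplus_le hε hε' hΔ hC hj hL hload hm hθ0.le hθ1 ω
  have hmean := coinAvgs_totalSurplus_le (κ := κ) hε hε' hΔ hC hC' hj ω
  have hmean' : 2 * ε * weight G ε j * ∑ v, load G ε κ j v ≤ 10 * ε * m * weight G ε j := by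
    have := weight_nonneg (G := G) hε j
    calc _ ≤ 2 * ε * weight G ε j * (5 * m) := by gcongr
      _ = _ := by ring
  calc _ ≤ coinAvgs (coinProb G ε C) (roundCoins V j).toList
        (fun ω => Real.exp (-(θ * t)) * Real.exp (θ * totalSurplus G ε C ω κ j)) ω := by
        refine coinAvgs_mono (fun q => coinProb_nonneg q) (fun q => coinProb_le_one q)
          (fun ω' => ?_) _ ω
        split_ifs with h
        · rw [← Real.exp_add, Real.one_le_exp_iff]
          have := mul_le_mul_of_nonneg_left h.le hθ0.le
          linarith
        · positivity
    _ ≤ Real.exp (-(θ * t)) * Real.exp (θ * (10 * ε * m * weight G ε j)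
          + θ ^ 2 * L ^ 9 * (5 * m)) := by
        rw [coinAvgs_const_mul]
        refine mul_le_mul_of_nonneg_left (hexp.trans (Real.exp_le_exp.2 ?_)) (Real.exp_pos _).le
        gcongr
        exact hmean.trans hmean'
    _ = Real.exp (-(m / (20 * L ^ 17))) := by
        rw [← Real.exp_add]; congr 1
        rw [ht, hθ]; field_simp; ring
    _ ≤ Real.exp (-(10 * L)) := by
        rw [Real.exp_le_exp, neg_le_neg_iff, le_div_iff₀ (by positivity)]
        calc 10 * L * (20 * L ^ 17) = 200 * L ^ 18 := by ring
          _ ≤ m := hmL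

open Classical in
theorem coinAvgs_estimate_tail (hε : 0 < ε) (hε' : ε ≤ 1) (hΔ : 0 < G.maxDegree)
    (hC : 320 ≤ C) {j : ℕ} (hj : ¬ IsVanilla G ε j) {L : ℝ}
    (hL : L = Real.log (Fintype.card V)) {v : V} (hv : κ v = ⊤)
    (hload : L / 2 ≤ load G ε κ j v) (ω : Coins V) :
    coinAvgs (coinProb G ε C) (roundCoins V j).toList
      (fun ω => if estimate G ε C ω κ j v ≤ 1 - 10 * ε then 1 else 0) ω
      ≤ Real.exp (-(10 * L)) := by
  have hT := thousand_le_vanillaThreshold hε hε'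
  have hL1 : 1000 ≤ L := by
    have := vanillaThreshold_le_log hε hε' hΔ hj
    linarith
  have hell := vanillaThreshold_le_iterLog_phase hε hε' hΔ hj
  have hC1 : 1 ≤ C := by linarith
  have hmgf := fun θ hθ => coinAvgs_exp_estimate_le hε hε' hΔ hC1 hj hv (θ := θ) hθ ω
  set ell := iterLog V (phase G ε j)
  set B := C * ell
  have hB320 : 320 ≤ B := by nlinarith
  have hB : 0 < B := by linarith
  set c := load G ε κ j v
  -- The event puts the estimate below c/2. The exponent B/4 gains B c/8 and costs B c/16, and B ≥
  -- 320 with c ≥ L/2 leaves 10 L.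
  have hm := hmgf (-(B / 4)) (by rw [abs_neg, abs_of_pos (by positivity)]; linarith)
  calc _ ≤ coinAvgs (coinProb G ε C) (roundCoins V j).toList
        (fun ω => Real.exp (-(B / 8 * c)) *
          Real.exp (-(B / 4) * (estimate G ε C ω κ j v - c))) ω := by
        refine coinAvgs_mono (fun q => coinProb_nonneg q) (fun q => coinProb_le_one q)
          (fun ω' => ?_) _ ω
        split_ifs with h
        · rw [← Real.exp_add, Real.one_le_exp_iff]
          have : B * (estimate G ε C ω' κ j v - c / 2) ≤ 0 :=
            mul_nonpos_of_nonneg_of_nonpos hB.le (by linarith)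
          linarith
        · positivity
    _ ≤ Real.exp (-(B / 8 * c)) * Real.exp ((-(B / 4)) ^ 2 * (1 / B) * c) := by
        rw [coinAvgs_const_mul]
        exact mul_le_mul_of_nonneg_left hm (Real.exp_pos _).le
    _ = Real.exp (-(B * c / 16)) := by
        rw [← Real.exp_add]; congr 1
        field_simp; ring
    _ ≤ Real.exp (-(10 * L)) := by
        rw [Real.exp_le_exp, neg_le_neg_iff]
        nlinarith

end Concentration

/-! ### Failure events, induction over rounds and the union bound. -/

section HighProbability

variable {V : Type*} [Fintype V] [DecidableEq V] {G : SimpleGraph V} [DecidableRel G.Adj]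
  {ε C : ℝ}

theorem coinLaw_eq : coinLaw G ε C = coinMeasure fun q : ℕ × ℕ × V => samplingProb G ε C q.2.1 :=
  rfl

theorem estimate_congr {ω ω' : Coins V} {j : ℕ} (h : ∀ i ≤ j, ∀ u, ω (j, i, u) = ω' (j, i, u))
    (κ : State V) (v : V) : estimate G ε C ω κ j v = estimate G ε C ω' κ j v := by
  rw [estimate_eq_sum_share, estimate_eq_sum_share]
  refine Finset.sum_congr rfl fun i hi => Finset.sum_congr rfl fun u _ => ?_
  rw [h i (Nat.lt_succ_iff.1 (Finset.mem_range.1 hi))]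

theorem run_congr {ω ω' : Coins V} {j : ℕ}
    (h : ∀ k < j, ∀ i ≤ k, ∀ u, ω (k, i, u) = ω' (k, i, u)) :
    run G ε C ω j = run G ε C ω' j := by
  induction j with
  | zero => rfl
  | succ j ih =>
    have ih := ih fun k hk => h k (by omega)
    funext v
    rw [run_succ, run_succ, ih, Freezes, Freezes,
      estimate_congr (h j (Nat.lt_succ_self j)) (run G ε C ω' j) v]

theorem run_update (ω : Coins V) (j : ℕ) {q : ℕ × ℕ × V} (hq : q ∈ (roundCoins V j).toList)
    (b : Bool) : run G ε C (Function.update ω q b) j = run G ε C ω j := by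
  refine run_congr fun k hk i _ u => Function.update_of_ne ?_ _ _
  rintro rfl
  rw [Finset.mem_toList, mem_roundCoins] at hq
  exact hk.ne hq.1

theorem totalSurplus_congr {ω ω' : Coins V} {j : ℕ}
    (h : ∀ i ≤ j, ∀ u, ω (j, i, u) = ω' (j, i, u)) (κ : State V) :
    totalSurplus G ε C ω κ j = totalSurplus G ε C ω' κ j := by
  unfold totalSurplus surplus
  simp only [estimate_congr h]

open Classical in
/-- An event about the state at the beginning of round `j` and the coins of round `j` is at most as
likely as it is, in the worst case, for a fixed state. -/
theorem coinLaw_real_le_of_state {j : ℕ} {Q : State V → Coins V → Prop}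
    (hQ : ∀ κ ω ω', (∀ i ≤ j, ∀ u, ω (j, i, u) = ω' (j, i, u)) → Q κ ω → Q κ ω') {δ : ℝ}
    (h : ∀ κ ω, coinAvgs (coinProb G ε C) (roundCoins V j).toList
      (fun ω => if Q κ ω then 1 else 0) ω ≤ δ) :
    (coinLaw G ε C).real {ω | Q (run G ε C ω j) ω} ≤ δ := by
  rw [coinLaw_eq]
  refine coinMeasure_real_le _ ?_ (roundCoins V j).toList fun ω => ?_
  · refine measurableSet_of_finite_coins
      (Finset.range (j + 1) ×ˢ Finset.range (j + 1) ×ˢ Finset.univ) fun ω ω' he hω => ?_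
    have he : ∀ k ≤ j, ∀ i ≤ j, ∀ u, ω (k, i, u) = ω' (k, i, u) := fun k hk i hi u =>
      he _ (by simp [hk, hi])
    have hr : run G ε C ω j = run G ε C ω' j :=
      run_congr fun k hk i hi u => he k hk.le i (hi.trans hk.le) u
    rw [Set.mem_ofPred_eq] at hω ⊢
    rw [← hr]
    exact hQ _ _ _ (he j le_rfl) hω
  · refine le_trans (le_of_eq ?_) (h (run G ε C ω j) ω)
    have e : ({ω | Q (run G ε C ω j) ω} : Set (Coins V)).indicator 1
        = fun ω => (fun κ ω => if Q κ ω then (1 : ℝ) else 0) (run G ε C ω j) ω := by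
      funext ω; simp [Set.indicator_apply]
    rw [e]
    exact coinAvgs_freeze (fun ω => run G ε C ω j) (fun κ ω => if Q κ ω then (1 : ℝ) else 0) _
      (fun ω q hq b => run_update ω j hq b) ω

/-- The failure of round `j`: the surplus is large although the values at its beginning are not. -/
def SurplusFailure (G : SimpleGraph V) [DecidableRel G.Adj] (ε C m : ℝ) (j : ℕ)
    (κ : State V) (ω : Coins V) : Prop :=
  (∀ u, load G ε κ j u ≤ Real.log (Fintype.card V)) ∧ ∑ u, load G ε κ j u ≤ 5 * m ∧
    10 * ε * m * weight G ε j + m / Real.log (Fintype.card V) ^ 4 < totalSurplus G ε C ω κ j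

/-- The failure of an active node of large value to freeze in round `j`. -/
def FreezeFailure (G : SimpleGraph V) [DecidableRel G.Adj] (ε C : ℝ) (j : ℕ) (v : V)
    (κ : State V) (ω : Coins V) : Prop :=
  κ v = ⊤ ∧ Real.log (Fintype.card V) / 2 ≤ load G ε κ j v ∧
    estimate G ε C ω κ j v ≤ 1 - 10 * ε

theorem coinLaw_surplusFailure_le (hε : 0 < ε) (hε' : ε ≤ 1) (hΔ : 0 < G.maxDegree)
    (hC : 1 ≤ C) (hC' : 20 / ε ^ 2 ≤ C) {j : ℕ} (hj : ¬ IsVanilla G ε j) {m : ℝ}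
    (hmL : 200 * Real.log (Fintype.card V) ^ 18 ≤ m) :
    (coinLaw G ε C).real {ω | SurplusFailure G ε C m j (run G ε C ω j) ω}
      ≤ Real.exp (-(10 * Real.log (Fintype.card V))) := by
  classical
  refine coinLaw_real_le_of_state (fun κ ω ω' h hω => ?_) fun κ ω => ?_
  · unfold SurplusFailure at hω ⊢
    rwa [← totalSurplus_congr h]
  · by_cases hκ : (∀ u, load G ε κ j u ≤ Real.log (Fintype.card V)) ∧
        ∑ u, load G ε κ j u ≤ 5 * m
    · refine le_trans (le_of_eq ?_)
        (coinAvgs_totalSurplus_tail hε hε' hΔ hC hC' hj rfl hκ.1 hκ.2 hmL ω)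
      simp [SurplusFailure, hκ]
    -- For a state with large values the event is empty; including the conditions on the state in
    -- the event allows a bound uniform over all states.
    · have e : ∀ ω, ¬ SurplusFailure G ε C m j κ ω := fun ω h => hκ ⟨h.1, h.2.1⟩
      simp only [e, if_false, coinAvgs_const]
      positivity

theorem coinLaw_freezeFailure_le (hε : 0 < ε) (hε' : ε ≤ 1) (hΔ : 0 < G.maxDegree)
    (hC : 320 ≤ C) {j : ℕ} (hj : ¬ IsVanilla G ε j) (v : V) :
    (coinLaw G ε C).real {ω | FreezeFailure G ε C j v (run G ε C ω j) ω}
      ≤ Real.exp (-(10 * Real.log (Fintype.card V))) := by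
  classical
  refine coinLaw_real_le_of_state (fun κ ω ω' h hω => ?_) fun κ ω => ?_
  · unfold FreezeFailure at hω ⊢
    rwa [← estimate_congr h]
  · by_cases hκ : κ v = ⊤ ∧ Real.log (Fintype.card V) / 2 ≤ load G ε κ j v
    · refine le_trans (le_of_eq ?_)
        (coinAvgs_estimate_tail hε hε' hΔ hC hj rfl hκ.1 hκ.2 ω)
      simp [FreezeFailure, hκ]
    · have e : ∀ ω, ¬ FreezeFailure G ε C j v κ ω := fun ω h => hκ ⟨h.1, h.2.1⟩
      simp only [e, if_false, coinAvgs_const]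
      positivity

theorem sum_surplus_allowance_le (hε : 0 < ε) (hε' : ε ≤ 1 / 1000) (hΔ : 0 < G.maxDegree)
    {m : ℝ} (hm : 0 ≤ m) (j : ℕ) :
    ∑ k ∈ samplingRounds G ε j,
      (10 * ε * m * weight G ε k + m / Real.log (Fintype.card V) ^ 4) ≤ ε ^ 2 * m := by
  have hε1 : ε ≤ 1 := by linarith
  rcases (samplingRounds G ε j).eq_empty_or_nonempty with h | h
  · rw [h, Finset.sum_empty]; positivity
  set a := (samplingRounds G ε j).max' h
  have ha : ¬ IsVanilla G ε a := (mem_samplingRounds.1 (Finset.max'_mem _ h)).2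
  have hsub : samplingRounds G ε j ⊆ Finset.range (a + 1) := fun k hk =>
    Finset.mem_range.2 (Nat.lt_succ_of_le (Finset.le_max' _ k hk))
  have hT := thousand_le_vanillaThreshold hε hε1
  have hT2 := thousand_div_sq_le_vanillaThreshold hε
  have hTL := vanillaThreshold_le_log hε hε1 hΔ ha
  have hcount := add_one_le_log_sq hε hε1 hΔ ha
  have hwa := weight_le_of_not_isVanilla hε hε1 hΔ ha
  have hw0 := weight_nonneg (G := G) hε
  set L := Real.log (Fintype.card V)
  set T := vanillaThreshold ε
  have hT0 : 0 < T := by linarith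
  have hL0 : 0 < L := by linarith
  -- The geometric series is dominated by the last sampling round `a`; its 1/ε cancels the ε gained
  -- in the expected surplus.
  have hsum : ∑ k ∈ Finset.range (a + 1), weight G ε k ≤ 2 * weight G ε a / ε := by
    refine (sum_weight_le hε (a + 1)).trans ?_
    have := hw0 a
    rw [weight_succ]
    gcongr
    linarith
  have hTinv : 1 / T ≤ ε ^ 2 / 1000 := by
    rw [div_le_div_iff₀ hT0 (by norm_num)]
    rw [div_le_iff₀ (by positivity)] at hT2
    linarith
  have hT5 : 1 / T ^ 5 ≤ 1 / T := by
    apply one_div_le_one_div_of_le hT0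
    exact le_self_pow₀ (by linarith) (by norm_num)
  have hL2 : 1 / L ^ 2 ≤ 1 / T := by
    apply one_div_le_one_div_of_le hT0
    exact hTL.trans (le_self_pow₀ (by linarith) (by norm_num))
  calc _ ≤ ∑ k ∈ Finset.range (a + 1), (10 * ε * m * weight G ε k + m / L ^ 4) :=
        Finset.sum_le_sum_of_subset_of_nonneg hsub fun k _ _ => by
          have := hw0 k
          positivity
    _ = 10 * ε * m * ∑ k ∈ Finset.range (a + 1), weight G ε k + ((a : ℝ) + 1) * (m / L ^ 4) := by
        rw [Finset.sum_add_distrib, Finset.mul_sum, Finset.sum_const, Finset.card_range,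
          nsmul_eq_mul]
        push_cast; ring
    _ ≤ 10 * ε * m * (2 * weight G ε a / ε) + L ^ 2 * (m / L ^ 4) := by gcongr
    _ = 20 * m * weight G ε a + m * (1 / L ^ 2) := by field_simp; ring
    _ ≤ 20 * m * (1 / T) + m * (1 / T) := by
        gcongr; exact hwa.trans hT5
    _ ≤ 20 * m * (ε ^ 2 / 1000) + m * (ε ^ 2 / 1000) := by gcongr
    _ ≤ ε ^ 2 * m := by nlinarith [mul_nonneg (sq_nonneg ε) hm]

/-- Without failures the values stay small. -/
theorem load_le_log_of_not_freezeFailure (hε : 0 < ε) (hε' : ε ≤ 1 / 1000)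
    (hΔ : 0 < G.maxDegree) {ω : Coins V}
    (hF : ∀ k, ¬ IsVanilla G ε k → ∀ v, ¬ FreezeFailure G ε C k v (run G ε C ω k) ω)
    {j : ℕ} (hj : ¬ IsVanilla G ε j) (v : V) :
    load G ε (freezeRound G ε C ω) j v ≤ Real.log (Fintype.card V) := by
  by_contra! hlt
  have hL : 1000 ≤ Real.log (Fintype.card V) :=
    (thousand_le_vanillaThreshold hε (by linarith)).trans
      (vanillaThreshold_le_log hε (by linarith) hΔ hj)
  obtain ⟨k, _, hnv, htop, hle, hest⟩ :=
    exists_surplus_of_one_lt_load hε v j (show 1 < load G ε (freezeRound G ε C ω) j v by linarith)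
  -- The failure is defined with half of log n because one growth step separates the values in
  -- rounds `k` and `j`.
  refine hF k hnv v ⟨htop, ?_, hest⟩
  rw [load_run]
  have := load_nonneg (G := G) hε (freezeRound G ε C ω) k v
  nlinarith

/-- Without failures the total surplus stays small. -/
theorem sum_totalSurplus_le_of_no_failure (hε : 0 < ε) (hε' : ε ≤ 1 / 1000)
    (hΔ : 0 < G.maxDegree) {M : Sym2 V → ℝ} (hM : IsMaxFractionalMatching G M) {ω : Coins V}
    (hF : ∀ k, ¬ IsVanilla G ε k → ∀ v, ¬ FreezeFailure G ε C k v (run G ε C ω k) ω)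
    (hS : ∀ k, ¬ IsVanilla G ε k → ¬ SurplusFailure G ε C (size G M) k (run G ε C ω k) ω)
    (j : ℕ) :
    ∑ k ∈ samplingRounds G ε j, totalSurplus G ε C ω (run G ε C ω k) k ≤ ε ^ 2 * size G M := by
  have hm : 0 ≤ size G M := Finset.sum_nonneg fun e he =>
    hM.1.1 e (SimpleGraph.mem_edgeFinset.1 he)
  induction j using Nat.strong_induction_on with
  | _ j ih =>
    refine (Finset.sum_le_sum fun k hk => ?_).trans (sum_surplus_allowance_le hε hε' hΔ hm j)
    obtain ⟨hkj, hnv⟩ := mem_samplingRounds.1 hk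
    by_contra! hlt
    refine hS k hnv ⟨fun u => ?_, ?_, hlt⟩
    · rw [load_run]
      exact load_le_log_of_not_freezeFailure hε hε' hΔ hF hnv u
    -- The induction hypothesis for the rounds before `k` bounds the values in round `k`, so
    -- exceeding the allowance would be a failure.
    · have h1 := sum_load_le (C := C) (ω := ω) hM hε hε' k
      have h2 := ih k hkj
      simp only [load_run]
      have h3 : ε * ∑ v, load G ε (freezeRound G ε C ω) k v ≤ ε * (5 * size G M) := by
        have : ε ^ 2 * size G M ≤ ε * size G M := by gcongr; nlinarith
        have : 0 ≤ ε * size G M := by positivity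
        linarith
      exact le_of_mul_le_mul_left h3 hε

theorem exp_neg_ten_mul_log {n : ℝ} (hn : 0 < n) : Real.exp (-(10 * Real.log n)) = 1 / n ^ 10 := by
  rw [Real.exp_neg, mul_comm, Real.exp_mul, Real.exp_log hn, one_div]
  norm_cast

theorem one_sub_le_coinLaw (hε : 0 < ε) (hε' : ε ≤ 1 / 1000) (hC : 320 ≤ C)
    (hC' : 20 / ε ^ 2 ≤ C) (hΔ : 0 < G.maxDegree) {M : Sym2 V → ℝ}
    (hM : IsMaxFractionalMatching G M)
    (hmL : 200 * Real.log (Fintype.card V) ^ 18 ≤ size G M) :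
    1 - 1 / (Fintype.card V : ℝ) ^ 6 ≤ (coinLaw G ε C).real
      {ω | size G M ≤ (2 + 100 * ε) * size G (output G ε C ω)} := by
  classical
  have hε1 : ε ≤ 1 := by linarith
  have hprob : IsProbabilityMeasure (coinLaw G ε C) := by rw [coinLaw_eq]; infer_instance
  have hn : (2 : ℝ) ≤ Fintype.card V := by
    have := one_lt_card_of_maxDegree_pos hΔ
    exact_mod_cast this
  set n := (Fintype.card V : ℝ)
  have hn0 : 0 < n := by linarith
  set L := Real.log n
  set N := ⌊L ^ 2⌋₊
  set Bad : ℕ → Set (Coins V) := fun j =>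
    {ω | SurplusFailure G ε C (size G M) j (run G ε C ω j) ω} ∪
      ⋃ v ∈ (Finset.univ : Finset V), {ω | FreezeFailure G ε C j v (run G ε C ω j) ω} with hBad
  have hN : ∀ j, ¬ IsVanilla G ε j → j ∈ samplingRounds G ε N := fun j hj => by
    refine mem_samplingRounds.2 ⟨?_, hj⟩
    have := add_one_le_log_sq hε hε1 hΔ hj
    -- The bound on j + 1, not just on j, yields j < ⌊L²⌋.
    exact Nat.le_floor (by push_cast; exact this)
  have hgood : ({ω | size G M ≤ (2 + 100 * ε) * size G (output G ε C ω)} : Set (Coins V))ᶜ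
      ⊆ ⋃ j ∈ samplingRounds G ε N, Bad j := by
    intro ω hω
    by_contra hbad
    simp only [hBad, Set.mem_iUnion, Set.mem_union, Set.mem_ofPred_eq, not_exists, not_or,
      Finset.mem_univ, true_and, exists_prop, not_and] at hbad
    refine hω (size_le_of_sum_totalSurplus_le hε hε' hM
      (sum_totalSurplus_le_of_no_failure hε hε' hΔ hM ?_ ?_ _))
    · exact fun k hk v => (hbad k (hN k hk)).2 v
    · exact fun k hk => (hbad k (hN k hk)).1
  have hBadle : ∀ j ∈ samplingRounds G ε N, (coinLaw G ε C).real (Bad j) ≤ (1 + n) / n ^ 10 := by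
    intro j hj
    have hj := (mem_samplingRounds.1 hj).2
    refine (measureReal_union_le _ _).trans ?_
    have h1 := coinLaw_surplusFailure_le hε hε1 hΔ (by linarith) hC' hj hmL
    have h2 : (coinLaw G ε C).real
        (⋃ v ∈ (Finset.univ : Finset V), {ω | FreezeFailure G ε C j v (run G ε C ω j) ω})
        ≤ n * (1 / n ^ 10) := by
      refine (measureReal_biUnion_finset_le _ _).trans ?_
      refine (Finset.sum_le_sum fun v _ => coinLaw_freezeFailure_le hε hε1 hΔ hC hj v).trans ?_
      rw [Finset.sum_const, nsmul_eq_mul, Finset.card_univ, exp_neg_ten_mul_log hn0]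
    rw [exp_neg_ten_mul_log hn0] at h1
    calc _ ≤ 1 / n ^ 10 + n * (1 / n ^ 10) := add_le_add h1 h2
      _ = _ := by ring
  have hcard : ((samplingRounds G ε N).card : ℝ) ≤ L ^ 2 := by
    have h1 : (samplingRounds G ε N).card ≤ N := by
      refine (Finset.card_le_card fun k hk => Finset.mem_range.2 (mem_samplingRounds.1 hk).1).trans
        (Finset.card_range N).le
    exact (Nat.cast_le.2 h1).trans (Nat.floor_le (sq_nonneg L))
  have hbound : (coinLaw G ε C).real (⋃ j ∈ samplingRounds G ε N, Bad j) ≤ 1 / n ^ 6 := by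
    refine (measureReal_biUnion_finset_le _ _).trans ((Finset.sum_le_sum hBadle).trans ?_)
    rw [Finset.sum_const, nsmul_eq_mul]
    have hL0 : 0 ≤ L := Real.log_nonneg (by linarith)
    have hLn : L ≤ n := (Real.log_le_sub_one_of_pos hn0).trans (by linarith)
    calc _ ≤ n ^ 2 * (n ^ 2 / n ^ 10) := by
          gcongr
          · exact hcard.trans (by gcongr)
          · nlinarith
      _ = 1 / n ^ 6 := by field_simp
  have huniv : (1 : ℝ) ≤ (coinLaw G ε C).real
      {ω | size G M ≤ (2 + 100 * ε) * size G (output G ε C ω)} + 1 / n ^ 6 := by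
    refine le_trans ?_
      (add_le_add_right ((measureReal_mono hgood (measure_ne_top _ _)).trans hbound) _)
    rw [← probReal_univ (μ := coinLaw G ε C), ← Set.union_compl_self
      {ω | size G M ≤ (2 + 100 * ε) * size G (output G ε C ω)}]
    exact measureReal_union_le _ _
  linarith

theorem size_eq_zero_of_maxDegree_eq_zero (hΔ : G.maxDegree = 0) (x : Sym2 V → ℝ) :
    size G x = 0 := by
  refine Finset.sum_eq_zero fun e he => ?_
  rw [SimpleGraph.mem_edgeFinset] at he
  induction e with | _ u v => ?_
  have := ((G.degree_pos_iff_exists_adj u).mpr ⟨v, he⟩).trans_le (G.degree_le_maxDegree u)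
  omega

end HighProbability

end SampledMatching

/-! ### The theorem; graphs without edges are treated separately, as the weights divide by Δ. -/

theorem mainTheorem3 :
    -- in every execution the output is a valid fractional matching
    (∀ (ε C : ℝ), 0 < ε → ε ≤ 1 / 1000 → 0 < C →
      ∀ (V : Type*) [Fintype V] [DecidableEq V] (G : SimpleGraph V) [DecidableRel G.Adj]
        (ω : SampledMatching.Coins V),
        SampledMatching.IsFractionalMatching G (SampledMatching.output G ε C ω)) ∧
    -- with high probability it is a good approximation
    ∃ K : ℝ, 0 < K ∧ ∀ ε : ℝ, 0 < ε → ε ≤ 1 / 1000 →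
      ∃ C₀ : ℝ, 0 < C₀ ∧ ∀ C : ℝ, C₀ ≤ C →
        ∀ (V : Type*) [Fintype V] [DecidableEq V] (G : SimpleGraph V) [DecidableRel G.Adj]
          (M : Sym2 V → ℝ), SampledMatching.IsMaxFractionalMatching G M →
          K * Real.log (Fintype.card V : ℝ) ^ 18 ≤ SampledMatching.size G M →
          1 - 1 / (Fintype.card V : ℝ) ^ 6 ≤
            (SampledMatching.coinLaw G ε C).real
              {ω | SampledMatching.size G M ≤
                (2 + 100 * ε) *
                  SampledMatching.size G (SampledMatching.output G ε C ω)} := by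
  refine ⟨fun ε C hε _ _ V _ _ G _ ω => SampledMatching.isFractionalMatching_output hε,
    200, by norm_num, fun ε hε hε' => ⟨max 320 (20 / ε ^ 2), by positivity, ?_⟩⟩
  intro C hC V _ _ G _ M hM hmL
  rcases Nat.eq_zero_or_pos G.maxDegree with hΔ | hΔ
  · have hprob : IsProbabilityMeasure (SampledMatching.coinLaw G ε C) := by
      rw [SampledMatching.coinLaw_eq]; infer_instance
    simp only [SampledMatching.size_eq_zero_of_maxDegree_eq_zero hΔ, mul_zero, le_refl,
      Set.ofPred_true, probReal_univ]
    exact sub_le_self _ (by positivity)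
  · exact SampledMatching.one_sub_le_coinLaw hε hε' ((le_max_left _ _).trans hC)
      ((le_max_right _ _).trans hC) hΔ hM hmL
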